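/- Let $N\ge 2$ and $p\in(0,\infty)$. For a family $X=(x_1,\dots,x_N)$ of $N$ unit vectors in $\mathbb R^2$ (repetitions allowed), the $p$-frame potential is $$\mathrm{FP}_p(X)=\sum_{k=1}^N\ \sum_{l\ne k}|\langle x_k,x_l\rangle|^p .$$ An optimal configuration is a family of $N$ unit vectors in $\mathbb R^2$ that minimizes $\mathrm{FP}_p$ over all families of $N$ unit vectors in $\mathbb R^2$. It is called the unique optimal configuration if every optimal configuration has the form $(s_1Ux_{\pi(1)},\dots,s_NUx_{\pi(N)})$ for some orthogonal $2\times2$ matrix $U$, some permutation $\pi$ of $\{1,\dots,N\}$ and some signs $s_1,\dots,s_N\in\{1,-1\}$. Identify $\mathbb R^2$ with $\mathbb C$ and let $$X_N^{(h)}=\{e^{ik\pi/N}: k=0,1,\dots,N-1\}$$ be the $N$ equally spaced points on half of the unit circle. Put $T_N=2N-2$ if $N$ is even and $T_N=2N-4$ if $N$ is odd. (a) If $N=4$ and $p>2$, then $X_4^{(h)}$ is the unique optimal configuration. (b) If $N\ge5$ and $p>T_N$, then $X_N^{(h)}$ is the unique optimal configuration. (c) If $N\ge5$ and $p$ is an even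 integer with $2<p\le T_N$, then $X_N^{(h)}$ is an optimal configuration. -/

import Mathlib

namespace FramePotential

/-- An ordered family of `N` vectors in `ℝ^d` (repetitions are allowed). -/
abbrev Config (N d : ℕ) : Type := Fin N → EuclideanSpace ℝ (Fin d)

/-- All vectors of the family have Euclidean norm one, that is, `X ∈ S(N, d)`. -/
def IsUnitNorm {N d : ℕ} (X : Config N d) : Prop :=
  ∀ k, ‖X k‖ = 1

/-- The `p`-frame potential (for finite `p`), self inner products excluded. -/
noncomputable def potential {N d : ℕ} (p : ℝ) (X : Config N d) : ℝ :=
  ∑ k, ∑ l ∈ Finset.univ.erase k, |inner ℝ (X k) (X l)| ^ p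

/-- `X` is an optimal configuration: it minimizes the `p`-frame potential over all
families of `N` unit vectors in `ℝ^d`. -/
def IsOptimal {N d : ℕ} (p : ℝ) (X : Config N d) : Prop :=
  IsUnitNorm X ∧ ∀ Y : Config N d, IsUnitNorm Y → potential p X ≤ potential p Y

/-- Two families are equivalent if one is obtained from the other by an orthogonal
transformation, a permutation and sign switches. -/
def Equivalent {N d : ℕ} (X Y : Config N d) : Prop :=
  ∃ (U : EuclideanSpace ℝ (Fin d) ≃ₗᵢ[ℝ] EuclideanSpace ℝ (Fin d))
    (π : Equiv.Perm (Fin N)) (s : Fin N → ℝ),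
    (∀ k, s k = 1 ∨ s k = -1) ∧ ∀ k, Y k = s k • U (X (π k))

/-- `X` is the unique optimal configuration, up to equivalence. -/
def IsUniqueOptimal {N d : ℕ} (p : ℝ) (X : Config N d) : Prop :=
  IsOptimal p X ∧ ∀ Y : Config N d, IsOptimal p Y → Equivalent X Y

/-- The `N` equally spaced points `e^{ikπ/N}`, `0 ≤ k ≤ N - 1`, on half of the unit circle,
as vectors of `ℝ²`. -/
noncomputable def halfCircle (N : ℕ) : Config N 2 :=
  fun k => !₂[Real.cos ((k : ℕ) * Real.pi / N), Real.sin ((k : ℕ) * Real.pi / N)]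

/-- `2N - 2` for even `N` and `2N - 4` for odd `N`. -/
noncomputable def threshold (N : ℕ) : ℝ :=
  if Even N then 2 * (N : ℝ) - 2 else 2 * (N : ℝ) - 4

end FramePotential

/-!
Write each unit vector as `(cos θ, sin θ)`. Up to sign only the doubled angles `2 θ` matter: with
`t = cos (2 (θₖ - θₗ))` a pair contributes `((1 + t) / 2) ^ s`, `s = p / 2`, and the half-circle
configuration becomes the regular `N`-gon.

*Linear programming bound.* Suppose that `h t ≤ ((1 + t) / 2) ^ s` on `[-1, 1]`, with equality at
the inner products of distinct vertices of the `N`-gon, and that `h (cos φ)` is a cosine polynomial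
of degree below `N` with nonnegative coefficients. The full double sum of `h` is then smallest for
the `N`-gon, because every frequency contributes a sum of two squares, which vanishes for the
`N`-gon (`IsPosTrig.sum_sum_le`). Hence the `N`-gon is optimal.

The function `h` is the Hermite interpolant of `((1 + t) / 2) ^ s`, double at each interior node
and simple at `-1` if `N` is even. In Newton's form (`eq_sum_iterSlope`) its coefficients are
divided differences of `(1 + t) ^ r`, whose signs are those of derivatives
(`exists_iterate_deriv_iterSlope_eq`); these are nonnegative in the orders needed when
`p > 2 N - 4` or when `p` is an even integer. With the nodes in increasing order, each partial
product is a product of two functions `∏ᵣ 2 cos (ψ + r π / N)`, `r` running through a centred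
arithmetic progression (`two_pow_mul_prod_hermiteNode`). By the Gaussian binomial theorem
(`centeredProd_eq_sum_exp`) the Fourier coefficients of these are ratios of products of positive
sines. Equality forces all angles between the lines to be multiples of `π / N`
(`centeredProd_eq_zero_iff`, `grid_of_grid_or_cos_eq_zero`), which is uniqueness.

*Four lines, `2 < p ≤ 4`.* Here the interpolant is not a minorant. Split the four lines into two
pairs as close to orthogonal as possible. Convexity reduces the claim to an inequality in the two
angles within the pairs and the angle between their bisectors, and Bernoulli's inequality reduces
this to a polynomial inequality (`quadratic_pos`, `four_le_sum_rpow`).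
-/

namespace FramePotential

open Set Filter Topology

/-! ### Iterated slopes and Hermite interpolation -/

theorem analyticOnNhd_dslope {f : ℝ → ℝ} {s : Set ℝ} {a : ℝ} (hf : AnalyticOnNhd ℝ f s) :
    AnalyticOnNhd ℝ (dslope f a) s := by
  intro b hb
  by_cases h : b = a
  · subst h
    obtain ⟨p, hp⟩ := hf b hb
    exact ⟨_, hp.has_fpower_series_dslope_fslope⟩
  · have hslope : AnalyticAt ℝ (fun t => (t - a)⁻¹ * (f t - f a)) b :=
      ((analyticAt_id.sub analyticAt_const).inv (sub_ne_zero.2 h)).mul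
        ((hf b hb).sub analyticAt_const)
    refine hslope.congr ?_
    filter_upwards [eventually_ne_nhds h] with t ht
    rw [dslope_of_ne _ ht, slope_def_field]
    ring

theorem hasDerivAt_iterate_deriv {f : ℝ → ℝ} {s : Set ℝ} (hf : AnalyticOnNhd ℝ f s) (k : ℕ)
    {t : ℝ} (ht : t ∈ s) : HasDerivAt (deriv^[k] f) (deriv^[k + 1] f t) t := by
  rw [Function.iterate_succ_apply']
  exact ((hf.iterated_deriv k) t ht).differentiableAt.hasDerivAt

/-- The Leibniz rule applied to `(t - a) * dslope f a t = f t - f a`. -/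
theorem iterate_deriv_dslope_leibniz {f : ℝ → ℝ} {s : Set ℝ} {a : ℝ} (hs : IsOpen s)
    (hf : AnalyticOnNhd ℝ f s) (k : ℕ) {t : ℝ} (ht : t ∈ s) :
    (t - a) * deriv^[k + 1] (dslope f a) t + (k + 1) * deriv^[k] (dslope f a) t
      = deriv^[k + 1] f t := by
  have hg : AnalyticOnNhd ℝ (dslope f a) s := analyticOnNhd_dslope hf
  induction k generalizing t with
  | zero =>
    have h1 : HasDerivAt (fun u => (u - a) * dslope f a u) _ t :=
      ((hasDerivAt_id t).sub_const a).mul (hasDerivAt_iterate_deriv hg 0 ht)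
    have h2 := (hasDerivAt_iterate_deriv hf 0 ht).sub_const (f a)
    have h3 : (fun u => (u - a) * dslope f a u) = fun u => f u - f a :=
      funext fun u => sub_smul_dslope f a u
    have h4 := h2.unique (h3 ▸ h1)
    simp only [id] at h4
    rw [h4]
    simp
    ring
  | succ k ih =>
    have h1 := (((hasDerivAt_id t).sub_const a).mul (hasDerivAt_iterate_deriv hg (k + 1) ht)).add
      ((hasDerivAt_iterate_deriv hg k ht).const_mul ((k : ℝ) + 1))
    have h2 := hasDerivAt_iterate_deriv hf (k + 1) ht
    have h3 : (fun u => (u - a) * deriv^[k + 1] (dslope f a) u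
        + ((k : ℝ) + 1) * deriv^[k] (dslope f a) u) =ᶠ[𝓝 t] deriv^[k + 1] f :=
      Filter.eventuallyEq_of_mem (hs.mem_nhds ht) fun u hu => ih hu
    have h4 := (h2.congr_of_eventuallyEq h3).unique h1
    rw [h4]
    simp only [id]
    push_cast
    ring

/-- Mean value theorem for slopes: since `(t - a) ^ (k + 1) * (dslope f a)⁽ᵏ⁾ t` has derivative
`(t - a) ^ k * f⁽ᵏ⁺¹⁾ t`, derivatives of the slope are positive multiples of values of the next
derivative of the function. -/
theorem exists_iterate_deriv_dslope_eq {f : ℝ → ℝ} {s : Set ℝ} {a : ℝ} (hs : IsOpen s)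
    (hc : Convex ℝ s) (hf : AnalyticOnNhd ℝ f s) (ha : a ∈ s) (k : ℕ) {t : ℝ} (ht : t ∈ s) :
    ∃ ρ > 0, ∃ ξ ∈ s, deriv^[k] (dslope f a) t = ρ * deriv^[k + 1] f ξ := by
  have hg : AnalyticOnNhd ℝ (dslope f a) s := analyticOnNhd_dslope hf
  have hD : ∀ u ∈ s, HasDerivAt (fun u => (u - a) ^ (k + 1) * deriv^[k] (dslope f a) u)
      ((u - a) ^ k * deriv^[k + 1] f u) u := by
    intro u hu
    have h := (((hasDerivAt_id u).sub_const a).pow (k + 1)).mul (hasDerivAt_iterate_deriv hg k hu)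
    refine h.congr_deriv ?_
    rw [← iterate_deriv_dslope_leibniz (a := a) hs hf k hu]
    simp only [id, Nat.add_sub_cancel]
    push_cast
    simp
    ring
  have key : t ≠ a → ∃ ξ ∈ s, 0 < (ξ - a) / (t - a) ∧
      (t - a) ^ (k + 1) * deriv^[k] (dslope f a) t
        = ((ξ - a) ^ k * deriv^[k + 1] f ξ) * (t - a) := by
    intro hta
    rcases lt_or_gt_of_ne hta with h | h
    · have hsub : Icc t a ⊆ s := hc.ordConnected.out ht ha
      obtain ⟨ξ, hξ, he⟩ := exists_hasDerivAt_eq_slope _ _ h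
        (fun u hu => (hD u (hsub hu)).continuousAt.continuousWithinAt)
        (fun u hu => hD u (hsub (Ioo_subset_Icc_self hu)))
      refine ⟨ξ, hsub (Ioo_subset_Icc_self hξ),
        div_pos_of_neg_of_neg (sub_neg.2 hξ.2) (sub_neg.2 h), ?_⟩
      rw [he]
      have : a - t ≠ 0 := (sub_pos.2 h).ne'
      field_simp
      simp
      ring
    · have hsub : Icc a t ⊆ s := hc.ordConnected.out ha ht
      obtain ⟨ξ, hξ, he⟩ := exists_hasDerivAt_eq_slope _ _ h
        (fun u hu => (hD u (hsub hu)).continuousAt.continuousWithinAt)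
        (fun u hu => hD u (hsub (Ioo_subset_Icc_self hu)))
      refine ⟨ξ, hsub (Ioo_subset_Icc_self hξ), div_pos (sub_pos.2 hξ.1) (sub_pos.2 h), ?_⟩
      rw [he]
      have : t - a ≠ 0 := (sub_pos.2 h).ne'
      field_simp
      simp
  by_cases hta : t = a
  · subst hta
    refine ⟨((k : ℝ) + 1)⁻¹, by positivity, t, ht, ?_⟩
    rw [← iterate_deriv_dslope_leibniz (a := t) hs hf k ht]
    field_simp
    simp
  · obtain ⟨ξ, hξ, hpos, he⟩ := key hta
    have h0 : t - a ≠ 0 := sub_ne_zero.2 hta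
    refine ⟨((ξ - a) / (t - a)) ^ k, pow_pos hpos k, ξ, hξ, ?_⟩
    apply mul_left_cancel₀ (pow_ne_zero (k + 1) h0)
    rw [he, div_pow, pow_succ]
    field_simp

/-- Iterated slopes of `f` along a sequence of nodes: `iterSlope f a n t` is the divided difference
`f[a 0, …, a (n - 1), t]`, nodes being allowed to coincide. -/
noncomputable def iterSlope (f : ℝ → ℝ) (a : ℕ → ℝ) : ℕ → ℝ → ℝ
  | 0 => f
  | n + 1 => dslope (iterSlope f a n) (a n)

/-- Newton's form of (Hermite) interpolation, with its remainder. -/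
theorem eq_sum_iterSlope (f : ℝ → ℝ) (a : ℕ → ℝ) (n : ℕ) (t : ℝ) :
    f t = ∑ j ∈ Finset.range n, iterSlope f a j (a j) * ∏ i ∈ Finset.range j, (t - a i)
      + iterSlope f a n t * ∏ i ∈ Finset.range n, (t - a i) := by
  induction n with
  | zero => simp [iterSlope]
  | succ n ih =>
    have h : (t - a n) * iterSlope f a (n + 1) t = iterSlope f a n t - iterSlope f a n (a n) :=
      sub_smul_dslope (iterSlope f a n) (a n) t
    rw [Finset.sum_range_succ, Finset.prod_range_succ]
    nth_rewrite 1 [ih]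
    linear_combination (- ∏ i ∈ Finset.range n, (t - a i)) * h

theorem analyticOnNhd_iterSlope {f : ℝ → ℝ} {s : Set ℝ} (a : ℕ → ℝ) (hf : AnalyticOnNhd ℝ f s)
    (n : ℕ) : AnalyticOnNhd ℝ (iterSlope f a n) s := by
  induction n with
  | zero => exact hf
  | succ n ih => exact analyticOnNhd_dslope ih

theorem exists_iterate_deriv_iterSlope_eq {f : ℝ → ℝ} {s : Set ℝ} {a : ℕ → ℝ} (hs : IsOpen s)
    (hc : Convex ℝ s) (hf : AnalyticOnNhd ℝ f s) {n : ℕ}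
    (ha : ∀ i < n, a i ∈ s) (k : ℕ) {t : ℝ} (ht : t ∈ s) :
    ∃ ρ > 0, ∃ ξ ∈ s, deriv^[k] (iterSlope f a n) t = ρ * deriv^[k + n] f ξ := by
  induction n generalizing k t with
  | zero => exact ⟨1, one_pos, t, ht, by simp [iterSlope]⟩
  | succ n ih =>
    obtain ⟨ρ, hρ, ξ, hξ, h⟩ := exists_iterate_deriv_dslope_eq hs hc
      (analyticOnNhd_iterSlope a hf n) (ha n n.lt_succ_self) k ht
    obtain ⟨ρ', hρ', ξ', hξ', h'⟩ :=
      ih (fun i hi => ha i (hi.trans n.lt_succ_self)) (k + 1) hξ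
    refine ⟨ρ * ρ', mul_pos hρ hρ', ξ', hξ', ?_⟩
    rw [iterSlope, h, h', ← mul_assoc, add_right_comm, add_assoc]

theorem iterSlope_nonneg {f : ℝ → ℝ} {s : Set ℝ} {a : ℕ → ℝ} (hs : IsOpen s)
    (hc : Convex ℝ s) (hf : AnalyticOnNhd ℝ f s) {n : ℕ} (ha : ∀ i < n, a i ∈ s)
    (h : ∀ ξ ∈ s, 0 ≤ deriv^[n] f ξ) {t : ℝ} (ht : t ∈ s) : 0 ≤ iterSlope f a n t := by
  obtain ⟨ρ, hρ, ξ, hξ, he⟩ := exists_iterate_deriv_iterSlope_eq hs hc hf ha 0 ht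
  rw [Nat.zero_add] at he
  exact (mul_nonneg hρ.le (h ξ hξ)).trans_eq he.symm

theorem iterSlope_pos {f : ℝ → ℝ} {s : Set ℝ} {a : ℕ → ℝ} (hs : IsOpen s)
    (hc : Convex ℝ s) (hf : AnalyticOnNhd ℝ f s) {n : ℕ} (ha : ∀ i < n, a i ∈ s)
    (h : ∀ ξ ∈ s, 0 < deriv^[n] f ξ) {t : ℝ} (ht : t ∈ s) : 0 < iterSlope f a n t := by
  obtain ⟨ρ, hρ, ξ, hξ, he⟩ := exists_iterate_deriv_iterSlope_eq hs hc hf ha 0 ht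
  rw [Nat.zero_add] at he
  exact (mul_pos hρ (h ξ hξ)).trans_eq he.symm

theorem iterate_deriv_one_add_rpow (r : ℝ) (k : ℕ) (t : ℝ) :
    deriv^[k] (fun t : ℝ => (1 + t) ^ r) t
      = (∏ i ∈ Finset.range k, (r - i)) * (1 + t) ^ (r - k) := by
  have h := congrFun (iteratedDeriv_comp_const_add k (fun x : ℝ => x ^ r) 1) t
  rw [← iteratedDeriv_eq_iterate, h, iteratedDeriv_eq_iterate,
    Real.iter_deriv_rpow_const, descPochhammer_eval_eq_prod_range]

theorem analyticOnNhd_one_add_rpow (r : ℝ) :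
    AnalyticOnNhd ℝ (fun t : ℝ => (1 + t) ^ r) (Ioi (-1)) := by
  intro t ht
  have h : (1 + t) ≠ 0 := by have := mem_Ioi.1 ht; linarith
  exact ((contDiffAt_const.add contDiffAt_id).rpow_const_of_ne h).analyticAt

/-! ### Trigonometric sums with nonnegative coefficients and Gaussian binomials -/

/-- Trigonometric sums `∑ i ≤ d, b i * cos ((d - 2 i) ψ)` with nonnegative coefficients. In the
variable `z = exp (2 i ψ)` these are the real parts of `z ^ (-d / 2)` times a polynomial of degree
at most `d` with nonnegative coefficients, which makes products additive in `d`. -/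
def IsPosTrig (d : ℕ) (h : ℝ → ℝ) : Prop :=
  ∃ b : ℕ → ℝ, (∀ i, 0 ≤ b i) ∧
    ∀ ψ, h ψ = ∑ i ∈ Finset.range (d + 1), b i * Real.cos (((d : ℝ) - 2 * i) * ψ)

namespace IsPosTrig

theorem add {d : ℕ} {f g : ℝ → ℝ} (hf : IsPosTrig d f) (hg : IsPosTrig d g) :
    IsPosTrig d (fun ψ => f ψ + g ψ) := by
  obtain ⟨b, hb, hf⟩ := hf
  obtain ⟨c, hc, hg⟩ := hg
  refine ⟨fun i => b i + c i, fun i => add_nonneg (hb i) (hc i), fun ψ => ?_⟩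
  simp only [hf, hg, ← Finset.sum_add_distrib, add_mul]

theorem const_mul {d : ℕ} {f : ℝ → ℝ} {r : ℝ} (hr : 0 ≤ r) (hf : IsPosTrig d f) :
    IsPosTrig d (fun ψ => r * f ψ) := by
  obtain ⟨b, hb, hf⟩ := hf
  refine ⟨fun i => r * b i, fun i => mul_nonneg hr (hb i), fun ψ => ?_⟩
  simp only [hf, Finset.mul_sum, mul_assoc]

theorem sum {ι : Type*} {d : ℕ} (s : Finset ι) {f : ι → ℝ → ℝ}
    (hf : ∀ i ∈ s, IsPosTrig d (f i)) : IsPosTrig d (fun ψ => ∑ i ∈ s, f i ψ) := by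
  classical
  induction s using Finset.induction_on with
  | empty => exact ⟨fun _ => 0, fun _ => le_rfl, fun ψ => by simp⟩
  | insert i s hi ih =>
    simp only [Finset.sum_insert hi]
    exact (hf i (Finset.mem_insert_self i s)).add
      (ih fun j hj => hf j (Finset.mem_insert_of_mem hj))

theorem cos_mul {d i : ℕ} (hi : i ≤ d) :
    IsPosTrig d (fun ψ => Real.cos (((d : ℝ) - 2 * i) * ψ)) := by
  refine ⟨fun j => if j = i then 1 else 0, fun j => by positivity, fun ψ => ?_⟩
  simp [ite_mul, Finset.sum_ite_eq', Nat.lt_succ_of_le hi]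

theorem mul {d e : ℕ} {f g : ℝ → ℝ} (hf : IsPosTrig d f) (hg : IsPosTrig e g) :
    IsPosTrig (d + e) (fun ψ => f ψ * g ψ) := by
  obtain ⟨b, hb, hf⟩ := hf
  obtain ⟨c, hc, hg⟩ := hg
  have h : (fun ψ => f ψ * g ψ) = fun ψ => ∑ i ∈ Finset.range (d + 1), ∑ j ∈ Finset.range (e + 1),
      (b i * c j / 2) * (Real.cos ((((d + e : ℕ) : ℝ) - 2 * (i + j : ℕ)) * ψ)
        + Real.cos ((((d + e : ℕ) : ℝ) - 2 * (i + (e - j) : ℕ)) * ψ)) := by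
    funext ψ
    rw [hf, hg, Finset.sum_mul_sum]
    refine Finset.sum_congr rfl fun i _ => Finset.sum_congr rfl fun j hj => ?_
    have hj : j ≤ e := Nat.lt_succ_iff.1 (Finset.mem_range.1 hj)
    have h1 : (((d + e : ℕ) : ℝ) - 2 * (i + j : ℕ)) * ψ
        = ((d : ℝ) - 2 * i) * ψ + ((e : ℝ) - 2 * j) * ψ := by push_cast; ring
    have h2 : (((d + e : ℕ) : ℝ) - 2 * (i + (e - j) : ℕ)) * ψ
        = ((d : ℝ) - 2 * i) * ψ - ((e : ℝ) - 2 * j) * ψ := by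
      push_cast [Nat.cast_sub hj]; ring
    rw [h1, h2, Real.cos_add, Real.cos_sub]
    ring
  rw [h]
  refine sum _ fun i hi => sum _ fun j hj => const_mul
    (div_nonneg (mul_nonneg (hb i) (hc j)) zero_le_two) (add (cos_mul ?_) (cos_mul ?_)) <;>
  · have := Finset.mem_range.1 hi
    have := Finset.mem_range.1 hj
    omega

end IsPosTrig

theorem sum_sum_cos_sub {ι : Type*} [Fintype ι] (c : ℝ) (θ : ι → ℝ) :
    ∑ k, ∑ l, Real.cos (c * (θ k - θ l))
      = (∑ k, Real.cos (c * θ k)) ^ 2 + (∑ k, Real.sin (c * θ k)) ^ 2 := by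
  simp only [sq, Finset.sum_mul_sum, ← Finset.sum_add_distrib, mul_sub, Real.cos_sub]

/-- Equally spaced angles annihilate every nonconstant frequency below `N`. -/
theorem sum_cos_sin_eq_zero {N : ℕ} {m : ℤ} (hm : m ≠ 0) (hmN : |m| < N) :
    ∑ k : Fin N, Real.cos (2 * m * ((k : ℕ) * Real.pi / N)) = 0 ∧
    ∑ k : Fin N, Real.sin (2 * m * ((k : ℕ) * Real.pi / N)) = 0 := by
  have hN : (N : ℂ) ≠ 0 := by
    have : (0 : ℤ) < N := lt_of_le_of_lt (abs_nonneg m) hmN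
    exact_mod_cast this.ne'
  set z : ℂ := Complex.exp (2 * Real.pi * m / N * Complex.I) with hz
  have hzN : z ^ N = 1 := by
    rw [hz, ← Complex.exp_nat_mul, Complex.exp_eq_one_iff]
    exact ⟨m, by field_simp⟩
  have hz1 : z ≠ 1 := by
    rw [hz, Ne, Complex.exp_eq_one_iff]
    rintro ⟨n, hn⟩
    have h2 : (2 * Real.pi * Complex.I : ℂ) ≠ 0 := Complex.two_pi_I_ne_zero
    have h3 : (m : ℂ) = n * N := by
      apply mul_left_cancel₀ h2
      field_simp at hn
      linear_combination (2 * Real.pi * Complex.I : ℂ) * hn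
    have h4 : m = n * N := by exact_mod_cast h3
    exact hm (Int.eq_zero_of_abs_lt_dvd ⟨n, by rw [h4]; ring⟩ hmN)
  have hsum : ∑ k ∈ Finset.range N, z ^ k = 0 := by
    have h := geom_sum_mul z N
    rw [hzN, sub_self] at h
    exact (mul_eq_zero.1 h).resolve_right (sub_ne_zero.2 hz1)
  have hk : ∀ k : ℕ, z ^ k = Complex.exp ((2 * m * (k * Real.pi / N) : ℝ) * Complex.I) := by
    intro k
    rw [hz, ← Complex.exp_nat_mul]
    congr 1
    push_cast
    ring
  rw [Fin.sum_univ_eq_sum_range (fun k => Real.cos (2 * m * ((k : ℕ) * Real.pi / N))),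
    Fin.sum_univ_eq_sum_range (fun k => Real.sin (2 * m * ((k : ℕ) * Real.pi / N)))]
  simp only [hk] at hsum
  constructor
  · have h := congrArg Complex.re hsum
    simpa only [Complex.re_sum, Complex.exp_ofReal_mul_I_re, Complex.zero_re] using h
  · have h := congrArg Complex.im hsum
    simpa only [Complex.im_sum, Complex.exp_ofReal_mul_I_im, Complex.zero_im] using h

/-- Among all families of `N` angles, the equally spaced one minimizes the full double sum of a
positive trigonometric sum whose frequencies are below `2 N`: the constant term contributes
`N ^ 2` in either case, and every other frequency a sum of two squares. -/
theorem IsPosTrig.sum_sum_le {N D : ℕ} (hD : D < N) {h : ℝ → ℝ} (hh : IsPosTrig (2 * D) h)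
    (θ : Fin N → ℝ) :
    ∑ k : Fin N, ∑ l : Fin N, h ((k : ℕ) * Real.pi / N - (l : ℕ) * Real.pi / N)
      ≤ ∑ k, ∑ l, h (θ k - θ l) := by
  obtain ⟨b, hb, hh⟩ := hh
  have key : ∀ ϑ : Fin N → ℝ, ∑ k, ∑ l, h (ϑ k - ϑ l) = ∑ i ∈ Finset.range (2 * D + 1),
      b i * ∑ k, ∑ l, Real.cos ((((2 * D : ℕ) : ℝ) - 2 * i) * (ϑ k - ϑ l)) := by
    intro ϑ
    simp only [hh, Finset.mul_sum]
    rw [Finset.sum_comm]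
    simp only [Finset.sum_comm (s := Finset.univ) (t := Finset.range (2 * D + 1))]
    refine Finset.sum_congr rfl fun i _ => ?_
    rw [Finset.sum_comm]
  rw [key θ, key fun k : Fin N => (k : ℕ) * Real.pi / N]
  refine Finset.sum_le_sum fun i hi => mul_le_mul_of_nonneg_left ?_ (hb i)
  have hi := Finset.mem_range.1 hi
  by_cases hiD : i = D
  · subst hiD
    simp
  · have hc : (((2 * D : ℕ) : ℝ) - 2 * i) = 2 * (((D : ℤ) - i : ℤ) : ℝ) := by push_cast; ring
    obtain ⟨h1, h2⟩ := sum_cos_sin_eq_zero (N := N) (m := (D : ℤ) - i) (by omega)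
      (by rw [abs_lt]; omega)
    rw [sum_sum_cos_sub, sum_sum_cos_sub, hc, h1, h2]
    simp only [ne_eq, OfNat.ofNat_ne_zero, not_false_eq_true, zero_pow, add_zero]
    exact add_nonneg (sq_nonneg _) (sq_nonneg _)

/-- The symmetric Gaussian binomial coefficient `[n, k]` at `q = exp (2 i a)`. -/
noncomputable def gaussCoeff (a : ℝ) (n k : ℕ) : ℝ :=
  ∏ i ∈ Finset.range k, Real.sin (((n : ℝ) - i) * a) / Real.sin (((i : ℝ) + 1) * a)

theorem gaussCoeff_self_succ (a : ℝ) (n : ℕ) : gaussCoeff a n (n + 1) = 0 :=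
  Finset.prod_eq_zero (Finset.self_mem_range_succ n) (by simp)

theorem gaussCoeff_nonneg {a : ℝ} {n k : ℕ} (ha : 0 ≤ a) (hn : n * a ≤ Real.pi) (hk : k ≤ n) :
    0 ≤ gaussCoeff a n k := by
  have hsin : ∀ x : ℝ, 0 ≤ x → x ≤ n → 0 ≤ Real.sin (x * a) := fun x h0 h1 =>
    Real.sin_nonneg_of_nonneg_of_le_pi (mul_nonneg h0 ha)
      ((mul_le_mul_of_nonneg_right h1 ha).trans hn)
  refine Finset.prod_nonneg fun i hi => ?_
  have hi : (i : ℝ) + 1 ≤ n := by exact_mod_cast (Finset.mem_range.1 hi).trans_le hk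
  have hi0 : (0 : ℝ) ≤ i := i.cast_nonneg
  exact div_nonneg (hsin _ (by linarith) (by linarith)) (hsin _ (by linarith) hi)

/-- Pascal's rule for Gaussian binomial coefficients. -/
theorem gaussCoeff_succ_succ {a : ℝ} {n k : ℕ} (hk : Real.sin (((k : ℝ) + 1) * a) ≠ 0) :
    (gaussCoeff a (n + 1) (k + 1) : ℂ)
      = gaussCoeff a n (k + 1) * Complex.exp ((((k : ℝ) + 1) * a : ℝ) * Complex.I)
        + gaussCoeff a n k * Complex.exp ((-(((n : ℝ) - k) * a) : ℝ) * Complex.I) := by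
  have h1 : gaussCoeff a n (k + 1)
      = gaussCoeff a n k * (Real.sin (((n : ℝ) - k) * a) / Real.sin (((k : ℝ) + 1) * a)) :=
    Finset.prod_range_succ _ _
  have h2 : gaussCoeff a (n + 1) (k + 1)
      = gaussCoeff a n k * (Real.sin (((n : ℝ) + 1) * a) / Real.sin (((k : ℝ) + 1) * a)) := by
    unfold gaussCoeff
    rw [Finset.prod_div_distrib, Finset.prod_div_distrib, Finset.prod_range_succ',
      Finset.prod_range_succ]
    have : ∀ i : ℕ, ((n + 1 : ℕ) : ℝ) - (i + 1 : ℕ) = n - i := fun i => by push_cast; ring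
    simp only [this]
    push_cast
    rw [sub_zero, mul_div_mul_comm]
  have h3 : Real.sin (((n : ℝ) + 1) * a)
      = Real.sin (((n : ℝ) - k) * a) * Real.cos (((k : ℝ) + 1) * a)
        + Real.cos (((n : ℝ) - k) * a) * Real.sin (((k : ℝ) + 1) * a) := by
    rw [← Real.sin_add]
    congr 1
    ring
  rw [h1, h2, h3]
  apply Complex.ext
  · simp only [Complex.add_re, Complex.re_ofReal_mul, Complex.ofReal_re,
      Complex.exp_ofReal_mul_I_re, Real.cos_neg]
    generalize Real.sin (((k : ℝ) + 1) * a) = S at hk ⊢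
    field_simp
  · simp only [Complex.add_im, Complex.im_ofReal_mul, Complex.ofReal_im,
      Complex.exp_ofReal_mul_I_im, Real.sin_neg]
    generalize Real.sin (((k : ℝ) + 1) * a) = S at hk ⊢
    field_simp
    ring

/-- The product of the `n` functions `2 cos (ψ + r a)`, with `r` running through the `n` numbers
of an arithmetic progression of step one centred at the origin. -/
noncomputable def centeredProd (a : ℝ) (n : ℕ) (ψ : ℝ) : ℝ :=
  ∏ r ∈ Finset.range n, (2 * Real.cos (ψ + ((r : ℝ) - ((n : ℝ) - 1) / 2) * a))

theorem centeredProd_zero (a ψ : ℝ) : centeredProd a 0 ψ = 1 := rfl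

theorem centeredProd_one (a ψ : ℝ) : centeredProd a 1 ψ = 2 * Real.cos ψ := by
  simp [centeredProd]

theorem centeredProd_succ (a : ℝ) (n : ℕ) (ψ : ℝ) :
    centeredProd a (n + 1) ψ = 2 * Real.cos (ψ + n * a / 2) * centeredProd a n (ψ - a / 2) := by
  unfold centeredProd
  rw [Finset.prod_range_succ, mul_comm]
  push_cast
  congr 1
  · congr 2
    ring
  · refine Finset.prod_congr rfl fun r _ => ?_
    congr 2
    ring

theorem centeredProd_add_two (a : ℝ) (n : ℕ) (ψ : ℝ) :
    centeredProd a (n + 2) ψ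
      = 2 * (Real.cos (2 * ψ) + Real.cos (((n : ℝ) + 1) * a)) * centeredProd a n ψ := by
  have h1 : Real.cos (2 * ψ) + Real.cos (((n : ℝ) + 1) * a)
      = 2 * Real.cos (ψ - ((n : ℝ) + 1) / 2 * a) * Real.cos (ψ + ((n : ℝ) + 1) / 2 * a) := by
    rw [Real.cos_add_cos, mul_assoc, mul_assoc,
      mul_comm (Real.cos (ψ - ((n : ℝ) + 1) / 2 * a))]
    congr 3 <;> ring
  have h2 : ∏ r ∈ Finset.range n, (2 * Real.cos (ψ + (((r + 1 : ℕ) : ℝ)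
      - (((n + 2 : ℕ) : ℝ) - 1) / 2) * a)) = centeredProd a n ψ := by
    refine Finset.prod_congr rfl fun r _ => ?_
    congr 2
    push_cast
    ring
  have h3 : ψ + (((n + 1 : ℕ) : ℝ) - (((n + 2 : ℕ) : ℝ) - 1) / 2) * a
      = ψ + ((n : ℝ) + 1) / 2 * a := by push_cast; ring
  have h4 : ψ + (((0 : ℕ) : ℝ) - (((n + 2 : ℕ) : ℝ) - 1) / 2) * a
      = ψ - ((n : ℝ) + 1) / 2 * a := by push_cast; ring
  rw [h1]
  conv_lhs => unfold centeredProd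
  rw [Finset.prod_range_succ, Finset.prod_range_succ', h2, h3, h4]
  ring

/-- The Gaussian binomial theorem. -/
theorem centeredProd_eq_sum_exp {a : ℝ} {n : ℕ}
    (ha : ∀ k < n, Real.sin (((k : ℝ) + 1) * a) ≠ 0) (ψ : ℝ) :
    (centeredProd a n ψ : ℂ) = ∑ k ∈ Finset.range (n + 1),
      gaussCoeff a n k * Complex.exp ((((n : ℝ) - 2 * k) * ψ : ℝ) * Complex.I) := by
  induction n generalizing ψ with
  | zero => simp [centeredProd, gaussCoeff]
  | succ n ih =>
    have hcos : ((2 * Real.cos (ψ + n * a / 2) : ℝ) : ℂ)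
        = Complex.exp ((ψ + n * a / 2 : ℝ) * Complex.I)
          + Complex.exp ((-(ψ + n * a / 2) : ℝ) * Complex.I) := by
      push_cast
      rw [Complex.two_cos]
    rw [centeredProd_succ, Complex.ofReal_mul, hcos,
      ih (fun k hk => ha k (hk.trans n.lt_succ_self))]
    set A : ℕ → ℂ := fun k => gaussCoeff a n k
      * Complex.exp ((((n : ℝ) + 1 - 2 * k) * ψ + k * a : ℝ) * Complex.I) with hA
    set B : ℕ → ℂ := fun k => gaussCoeff a n k
      * Complex.exp ((((n : ℝ) - 1 - 2 * k) * ψ - ((n : ℝ) - k) * a : ℝ) * Complex.I) with hB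
    have hAlast : A (n + 1) = 0 := by simp [hA, gaussCoeff_self_succ]
    have hL : (Complex.exp ((ψ + n * a / 2 : ℝ) * Complex.I)
          + Complex.exp ((-(ψ + n * a / 2) : ℝ) * Complex.I)) *
        ∑ k ∈ Finset.range (n + 1), gaussCoeff a n k
          * Complex.exp ((((n : ℝ) - 2 * k) * (ψ - a / 2) : ℝ) * Complex.I)
        = ∑ k ∈ Finset.range (n + 1), A k + ∑ k ∈ Finset.range (n + 1), B k := by
      rw [Finset.mul_sum, ← Finset.sum_add_distrib]
      refine Finset.sum_congr rfl fun k _ => ?_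
      have e1 : (((n : ℝ) + 1 - 2 * k) * ψ + k * a : ℝ) * Complex.I
          = (ψ + n * a / 2 : ℝ) * Complex.I
            + (((n : ℝ) - 2 * k) * (ψ - a / 2) : ℝ) * Complex.I := by
        push_cast; ring
      have e2 : (((n : ℝ) - 1 - 2 * k) * ψ - ((n : ℝ) - k) * a : ℝ) * Complex.I
          = (-(ψ + n * a / 2) : ℝ) * Complex.I
            + (((n : ℝ) - 2 * k) * (ψ - a / 2) : ℝ) * Complex.I := by
        push_cast; ring
      simp only [hA, hB]
      rw [e1, e2, Complex.exp_add, Complex.exp_add]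
      ring
    have hR : ∀ k ∈ Finset.range (n + 1), (gaussCoeff a (n + 1) (k + 1) : ℂ)
        * Complex.exp (((((n + 1 : ℕ) : ℝ) - 2 * ((k + 1 : ℕ) : ℝ)) * ψ : ℝ) * Complex.I)
        = A (k + 1) + B k := by
      intro k hk
      have e1 : (((n : ℝ) + 1 - 2 * ((k + 1 : ℕ) : ℝ)) * ψ + ((k + 1 : ℕ) : ℝ) * a : ℝ)
            * Complex.I = ((((k : ℝ) + 1) * a : ℝ) : ℂ) * Complex.I
            + ((((n + 1 : ℕ) : ℝ) - 2 * ((k + 1 : ℕ) : ℝ)) * ψ : ℝ) * Complex.I := by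
        push_cast; ring
      have e2 : (((n : ℝ) - 1 - 2 * k) * ψ - ((n : ℝ) - k) * a : ℝ) * Complex.I
          = (-(((n : ℝ) - k) * a) : ℝ) * Complex.I
            + ((((n + 1 : ℕ) : ℝ) - 2 * ((k + 1 : ℕ) : ℝ)) * ψ : ℝ) * Complex.I := by
        push_cast; ring
      simp only [hA, hB]
      rw [gaussCoeff_succ_succ (ha k (Finset.mem_range.1 hk)), e1, e2, Complex.exp_add,
        Complex.exp_add]
      ring
    rw [hL, Finset.sum_range_succ' _ (n + 1), Finset.sum_congr rfl hR, Finset.sum_add_distrib]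
    have h0 : (gaussCoeff a (n + 1) 0 : ℂ)
        * Complex.exp (((((n + 1 : ℕ) : ℝ) - 2 * ((0 : ℕ) : ℝ)) * ψ : ℝ) * Complex.I) = A 0 := by
      simp [hA, gaussCoeff]
    rw [h0, add_right_comm, ← Finset.sum_range_succ', Finset.sum_range_succ A (n + 1), hAlast,
      add_zero]

theorem isPosTrig_centeredProd {N n : ℕ} (hn : n < N) :
    IsPosTrig n (centeredProd (Real.pi / N) n) := by
  have hN : (0 : ℝ) < N := by exact_mod_cast (Nat.zero_le n).trans_lt hn
  have ha : 0 < Real.pi / N := div_pos Real.pi_pos hN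
  have hNa : N * (Real.pi / N) = Real.pi := by field_simp
  have hsin : ∀ k < n, Real.sin (((k : ℝ) + 1) * (Real.pi / N)) ≠ 0 := by
    intro k hk
    have hk' : (k : ℝ) + 1 < N := by exact_mod_cast (Nat.succ_le_of_lt hk).trans_lt hn
    exact (Real.sin_pos_of_pos_of_lt_pi (by positivity)
      ((mul_lt_mul_of_pos_right hk' ha).trans_eq hNa)).ne'
  refine ⟨fun k => if k ≤ n then gaussCoeff (Real.pi / N) n k else 0, fun k => ?_, fun ψ => ?_⟩
  · dsimp only
    split_ifs with hk
    · exact gaussCoeff_nonneg ha.le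
        ((mul_le_mul_of_nonneg_right (by exact_mod_cast hn.le) ha.le).trans_eq hNa) hk
    · exact le_rfl
  · have h := congrArg Complex.re (centeredProd_eq_sum_exp hsin ψ)
    rw [Complex.ofReal_re, Complex.re_sum] at h
    rw [h]
    refine Finset.sum_congr rfl fun k hk => ?_
    dsimp only
    rw [if_pos (Nat.lt_succ_iff.1 (Finset.mem_range.1 hk)), Complex.re_ofReal_mul,
      Complex.exp_ofReal_mul_I_re]

/-! ### The linear programming minorant -/

/-- The zeros of the centred product of length `N - 1` at step `π / N` are the nonzero points of
the grid `(π / N) ℤ` modulo `π`. -/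
theorem centeredProd_eq_zero_iff {N : ℕ} (hN : 0 < N) (ψ : ℝ) :
    centeredProd (Real.pi / N) (N - 1) ψ = 0 ↔
      ∃ i : ℤ, ¬ (N : ℤ) ∣ i ∧ ψ = i * Real.pi / N := by
  have hN0 : (N : ℝ) ≠ 0 := by exact_mod_cast hN.ne'
  have hN1 : ((N - 1 : ℕ) : ℝ) = N - 1 := by push_cast [Nat.cast_sub hN]; ring
  unfold centeredProd
  rw [Finset.prod_eq_zero_iff, hN1]
  constructor
  · rintro ⟨r, hr, h⟩
    have hr := Finset.mem_range.1 hr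
    obtain ⟨k, hk⟩ := Real.cos_eq_zero_iff.1 ((mul_eq_zero.1 h).resolve_left two_ne_zero)
    refine ⟨N * k + (N - 1 - r), ?_, ?_⟩
    · rw [dvd_add_right (dvd_mul_right _ _)]
      intro hd
      have := Int.le_of_dvd (by omega) hd
      omega
    · push_cast
      field_simp at hk ⊢
      linear_combination hk / 2
  · rintro ⟨i, hi, rfl⟩
    have hNz : (0 : ℤ) < N := by exact_mod_cast hN
    have h0 : 0 ≤ i % N := Int.emod_nonneg _ hNz.ne'
    have h1 : i % N < N := Int.emod_lt_of_pos _ hNz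
    have h2 : i % N ≠ 0 := fun h => hi (Int.dvd_of_emod_eq_zero h)
    refine ⟨(N - 1 - i % N).toNat, Finset.mem_range.2 (by omega), ?_⟩
    have h3 : (((N - 1 - i % N).toNat : ℕ) : ℝ) = N - 1 - ((i % N : ℤ) : ℝ) := by
      have h : (((N - 1 - i % N).toNat : ℕ) : ℤ) = N - 1 - i % N := Int.toNat_of_nonneg (by omega)
      exact_mod_cast congrArg (Int.cast : ℤ → ℝ) h
    have h4 : (i : ℝ) = N * ((i / N : ℤ) : ℝ) + ((i % N : ℤ) : ℝ) := by
      exact_mod_cast congrArg (Int.cast : ℤ → ℝ) (Int.mul_ediv_add_emod i N).symm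
    rw [mul_eq_zero, Real.cos_eq_zero_iff]
    refine Or.inr ⟨i / N, ?_⟩
    rw [h3, h4]
    field_simp
    ring

/-- The nodes of Hermite interpolation: each inner product `-cos ((n₀ + 2 i + 1) a)` is taken
twice, in increasing order. -/
noncomputable def hermiteNode (a : ℝ) (n₀ j : ℕ) : ℝ :=
  -Real.cos (((n₀ + 2 * (j / 2) : ℕ) + 1 : ℝ) * a)

/-- The partial products of Newton's form, times the factor `(1 + t) ^ n₀` accounting for a simple
node at `-1` when `n₀ = 1`, factor into centred products. -/
theorem two_pow_mul_prod_hermiteNode (a : ℝ) {n₀ : ℕ} (hn₀ : n₀ ≤ 1) (j : ℕ) (ψ : ℝ) :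
    2 ^ (n₀ + j) * ((1 + Real.cos (2 * ψ)) ^ n₀ *
        ∏ i ∈ Finset.range j, (Real.cos (2 * ψ) - hermiteNode a n₀ i))
      = centeredProd a (n₀ + 2 * (j / 2)) ψ * centeredProd a (n₀ + 2 * ((j + 1) / 2)) ψ := by
  induction j with
  | zero =>
    interval_cases n₀
    · simp [centeredProd_zero]
    · simp only [Finset.range_zero, Finset.prod_empty]
      norm_num [centeredProd_one, Real.cos_two_mul]
      ring
  | succ j ih =>
    have h1 : n₀ + 2 * ((j + 1 + 1) / 2) = n₀ + 2 * (j / 2) + 2 := by omega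
    have h2 : Real.cos (2 * ψ) - hermiteNode a n₀ j = Real.cos (2 * ψ)
        + Real.cos (((n₀ + 2 * (j / 2) : ℕ) + 1 : ℝ) * a) := by
      rw [hermiteNode, sub_neg_eq_add]
    rw [Finset.prod_range_succ, h1, centeredProd_add_two, h2, ← add_assoc, pow_succ]
    linear_combination (2 * (Real.cos (2 * ψ)
        + Real.cos (((n₀ + 2 * (j / 2) : ℕ) + 1 : ℝ) * a))) * ih

theorem neg_one_lt_hermiteNode {N n₀ M j : ℕ} (hN : n₀ + 2 * M + 1 = N) (hj : j < 2 * M) :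
    -1 < hermiteNode (Real.pi / N) n₀ j := by
  have hN0 : (0 : ℝ) < N := by exact_mod_cast (by omega : 0 < N)
  have hlt : ((n₀ + 2 * (j / 2) : ℕ) + 1 : ℝ) < N := by
    exact_mod_cast (by omega : n₀ + 2 * (j / 2) + 1 < N)
  have hpi : ((n₀ + 2 * (j / 2) : ℕ) + 1 : ℝ) * (Real.pi / N) < Real.pi := by
    rw [mul_div_left_comm]
    exact mul_lt_of_lt_one_right Real.pi_pos ((div_lt_one hN0).2 hlt)
  have h := Real.cos_lt_cos_of_nonneg_of_le_pi le_rfl hpi.le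
    (mul_pos (by positivity) (div_pos Real.pi_pos hN0))
  rw [Real.cos_zero] at h
  rw [hermiteNode]
  linarith

/-- The linear programming bound. The minorant is the Hermite interpolant of
`((1 + t) / 2) ^ s`, `t = cos 2ψ`, at the inner products of the equally spaced lines; its Newton
coefficients are nonnegative, and so are the Fourier coefficients of its partial products. -/
theorem exists_minorant {N n₀ M : ℕ} (hn₀ : n₀ ≤ 1) (hN : n₀ + 2 * M + 1 = N) {s : ℝ} (hs : 0 < s)
    (hprod : ∀ k ≤ 2 * M, 0 ≤ ∏ i ∈ Finset.range k, (s - n₀ - i)) :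
    ∃ h : ℝ → ℝ,
      (∀ θ : Fin N → ℝ,
        ∑ k : Fin N, ∑ l : Fin N, h ((k : ℕ) * Real.pi / N - (l : ℕ) * Real.pi / N)
          ≤ ∑ k, ∑ l, h (θ k - θ l)) ∧
      (∀ ψ, h ψ ≤ |Real.cos ψ| ^ (2 * s)) ∧
      (∀ ψ, centeredProd (Real.pi / N) (N - 1) ψ = 0 → h ψ = |Real.cos ψ| ^ (2 * s)) ∧
      (0 < ∏ i ∈ Finset.range (2 * M), (s - n₀ - i) →
        ∀ ψ, Real.cos ψ ≠ 0 → h ψ = |Real.cos ψ| ^ (2 * s) →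
          centeredProd (Real.pi / N) (N - 1) ψ = 0) := by
  set a := Real.pi / N with ha
  set g : ℝ → ℝ := fun t => (1 + t) ^ (s - n₀) with hg
  set node : ℕ → ℝ := hermiteNode a n₀ with hnode
  set W : ℕ → ℝ → ℝ := fun j t => (1 + t) ^ n₀ * ∏ i ∈ Finset.range j, (t - node i) with hW
  set γ : ℕ → ℝ := fun j => iterSlope g node j (node j) with hγ
  set H : ℝ → ℝ := fun t => (1 / 2 : ℝ) ^ s * ∑ j ∈ Finset.range (2 * M), γ j * W j t with hH
  have hhalf : (0 : ℝ) < (1 / 2 : ℝ) ^ s := by positivity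
  have hmem : ∀ i < 2 * M, node i ∈ Ioi (-1 : ℝ) := fun i hi => neg_one_lt_hermiteNode hN hi
  have hderiv : ∀ k ≤ 2 * M, ∀ ξ ∈ Ioi (-1 : ℝ), 0 ≤ deriv^[k] g ξ := by
    intro k hk ξ hξ
    rw [hg, iterate_deriv_one_add_rpow]
    exact mul_nonneg (hprod k hk) (Real.rpow_nonneg (by linarith [mem_Ioi.1 hξ]) _)
  have hrem : ∀ t ∈ Ioi (-1 : ℝ), 0 ≤ iterSlope g node (2 * M) t := fun t ht =>
    iterSlope_nonneg isOpen_Ioi (convex_Ioi _) (analyticOnNhd_one_add_rpow _) hmem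
      (hderiv _ le_rfl) ht
  have hγ0 : ∀ j < 2 * M, 0 ≤ γ j := fun j hj =>
    iterSlope_nonneg isOpen_Ioi (convex_Ioi _) (analyticOnNhd_one_add_rpow _)
      (fun i hi => hmem i (hi.trans hj)) (hderiv _ hj.le) (hmem j hj)
  -- The Newton remainder, valid on `(-1, ∞)`.
  have hnewton : ∀ t ∈ Ioi (-1 : ℝ), ((1 + t) / 2) ^ s - H t
      = (1 / 2 : ℝ) ^ s * (iterSlope g node (2 * M) t * W (2 * M) t) := by
    intro t ht
    have ht1 : 0 < 1 + t := by linarith [mem_Ioi.1 ht]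
    have h1 : ((1 + t) / 2) ^ s = (1 / 2 : ℝ) ^ s * ((1 + t) ^ n₀ * g t) := by
      rw [hg, div_eq_inv_mul, Real.mul_rpow (by norm_num) ht1.le]
      dsimp only
      rw [← Real.rpow_natCast, ← Real.rpow_add ht1]
      norm_num
    rw [h1, eq_sum_iterSlope g node (2 * M) t]
    simp only [hH, hW, hγ, mul_add, Finset.mul_sum]
    rw [add_comm, add_sub_assoc, ← Finset.sum_sub_distrib, Finset.sum_eq_zero, add_zero]
    · ring
    · intro j _
      ring
  have hWE : ∀ j ψ, 2 ^ (n₀ + j) * W j (Real.cos (2 * ψ))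
      = centeredProd a (n₀ + 2 * (j / 2)) ψ * centeredProd a (n₀ + 2 * ((j + 1) / 2)) ψ :=
    fun j ψ => two_pow_mul_prod_hermiteNode a hn₀ j ψ
  have hWlast : ∀ ψ, 2 ^ (n₀ + 2 * M) * W (2 * M) (Real.cos (2 * ψ))
      = centeredProd a (N - 1) ψ ^ 2 := by
    intro ψ
    rw [hWE, sq, show n₀ + 2 * (2 * M / 2) = N - 1 by omega,
      show n₀ + 2 * ((2 * M + 1) / 2) = N - 1 by omega]
  have hW0 : ∀ ψ, 0 ≤ W (2 * M) (Real.cos (2 * ψ)) := fun ψ =>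
    nonneg_of_mul_nonneg_right ((hWlast ψ).symm ▸ sq_nonneg _) (by positivity)
  have hcos : ∀ ψ, |Real.cos ψ| ^ (2 * s) = ((1 + Real.cos (2 * ψ)) / 2) ^ s := by
    intro ψ
    rw [Real.rpow_mul (abs_nonneg _), Real.rpow_two, sq_abs, Real.cos_sq]
    congr 1
    ring
  have hgt : ∀ ψ, Real.cos ψ ≠ 0 → Real.cos (2 * ψ) ∈ Ioi (-1 : ℝ) := by
    intro ψ hψ
    have := sq_pos_of_ne_zero hψ
    rw [mem_Ioi, Real.cos_two_mul]
    linarith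
  refine ⟨fun ψ => H (Real.cos (2 * ψ)), fun θ => ?_, fun ψ => ?_, fun ψ hψ => ?_,
    fun hlast ψ hψ heq => ?_⟩
  · -- Each Newton term is minimized by the equally spaced angles.
    have hterm : ∀ j < 2 * M, IsPosTrig (2 * (n₀ + j))
        (fun ψ => (1 / 2 : ℝ) ^ s * γ j * W j (Real.cos (2 * ψ))) := by
      intro j hj
      have hE := (isPosTrig_centeredProd (N := N) (n := n₀ + 2 * (j / 2)) (by omega)).mul
        (isPosTrig_centeredProd (N := N) (n := n₀ + 2 * ((j + 1) / 2)) (by omega))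
      rw [show n₀ + 2 * (j / 2) + (n₀ + 2 * ((j + 1) / 2)) = 2 * (n₀ + j) by omega] at hE
      refine IsPosTrig.const_mul (mul_nonneg hhalf.le (hγ0 j hj)) ?_
      convert hE.const_mul (r := ((2 : ℝ) ^ (n₀ + j))⁻¹) (by positivity) using 2 with ψ
      rw [← hWE, inv_mul_cancel_left₀ (by positivity)]
    have hswap : ∀ ϑ : Fin N → ℝ, ∑ k, ∑ l, H (Real.cos (2 * (ϑ k - ϑ l)))
        = ∑ j ∈ Finset.range (2 * M), ∑ k, ∑ l,
          (1 / 2 : ℝ) ^ s * γ j * W j (Real.cos (2 * (ϑ k - ϑ l))) := by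
      intro ϑ
      simp only [hH, Finset.mul_sum, ← mul_assoc]
      exact (Finset.sum_congr rfl fun k _ => Finset.sum_comm).trans Finset.sum_comm
    rw [hswap θ, hswap fun k : Fin N => (k : ℕ) * Real.pi / N]
    refine Finset.sum_le_sum fun j hj => ?_
    have hj := Finset.mem_range.1 hj
    exact (hterm j hj).sum_sum_le (by omega) θ
  · -- Nonnegativity of the remainder, extended to `t = -1` by continuity.
    have hclosed : IsClosed {t : ℝ | H t ≤ ((1 + t) / 2) ^ s} := by
      refine isClosed_le ?_ ?_
      · simp only [hH, hW]
        fun_prop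
      · exact ((continuous_const.add continuous_id).div_const 2).rpow_const fun _ => Or.inr hs.le
    have hsub : {t : ℝ | -1 < t ∧ t ∈ range (fun ψ : ℝ => Real.cos (2 * ψ))} ⊆
        {t : ℝ | H t ≤ ((1 + t) / 2) ^ s} := by
      rintro _ ⟨ht, ψ, rfl⟩
      have h := hnewton _ ht
      have h2 := mul_nonneg hhalf.le (mul_nonneg (hrem _ ht) (hW0 ψ))
      exact sub_nonneg.1 (h ▸ h2)
    have hIoo : Ioo (-1 : ℝ) 1 ⊆ {t : ℝ | H t ≤ ((1 + t) / 2) ^ s} := fun t ht =>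
      hsub ⟨ht.1, Real.arccos t / 2, by
        dsimp only
        rw [mul_div_cancel₀ _ two_ne_zero, Real.cos_arccos ht.1.le ht.2.le]⟩
    have hIcc := hclosed.closure_subset_iff.2 hIoo
    rw [closure_Ioo (by norm_num)] at hIcc
    rw [hcos]
    exact hIcc ⟨Real.neg_one_le_cos _, Real.cos_le_one _⟩
  · have hWz : W (2 * M) (Real.cos (2 * ψ)) = 0 := by
      have h := hWlast ψ
      rw [hψ] at h
      simpa using h
    by_cases hc : Real.cos ψ = 0
    · -- Here `t = -1`, which is a node only if `n₀ = 1`.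
      have ht : Real.cos (2 * ψ) = -1 := by rw [Real.cos_two_mul, hc]; norm_num
      have hne : ∏ i ∈ Finset.range (2 * M), ((-1 : ℝ) - node i) ≠ 0 :=
        Finset.prod_ne_zero_iff.2 fun i hi =>
          (sub_neg.2 (hmem i (Finset.mem_range.1 hi))).ne
      have hn : n₀ ≠ 0 := by
        rintro rfl
        rw [ht] at hWz
        simp only [hW, pow_zero, one_mul] at hWz
        exact hne hWz
      dsimp only
      rw [ht, hc, abs_zero, Real.zero_rpow (by positivity)]
      simp [hH, hW, hn]
    · have h := hnewton _ (hgt ψ hc)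
      rw [hWz, mul_zero, mul_zero, sub_eq_zero] at h
      rw [hcos, h]
  · have ht := hgt ψ hψ
    have h := hnewton _ ht
    rw [hcos] at heq
    dsimp only at heq
    rw [← heq, sub_self, zero_eq_mul, mul_eq_zero] at h
    have hpos : 0 < iterSlope g node (2 * M) (Real.cos (2 * ψ)) :=
      iterSlope_pos isOpen_Ioi (convex_Ioi _) (analyticOnNhd_one_add_rpow _) hmem
        (fun ξ hξ => by
          rw [iterate_deriv_one_add_rpow]
          exact mul_pos hlast (Real.rpow_pos_of_pos (by linarith [mem_Ioi.1 hξ]) _)) ht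
    have hz := (h.resolve_left hhalf.ne').resolve_left hpos.ne'
    have h2 := hWlast ψ
    rw [hz, mul_zero] at h2
    exact pow_eq_zero_iff two_ne_zero |>.1 h2.symm

/-! ### Configurations in terms of angles -/

/-- The family of unit vectors of the plane with prescribed polar angles. -/
noncomputable def ofAngles {N : ℕ} (θ : Fin N → ℝ) : Config N 2 :=
  fun k => !₂[Real.cos (θ k), Real.sin (θ k)]

theorem isUnitNorm_ofAngles {N : ℕ} (θ : Fin N → ℝ) : IsUnitNorm (ofAngles θ) := by
  intro k
  rw [EuclideanSpace.norm_eq, Real.sqrt_eq_one]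
  simp [ofAngles, Fin.sum_univ_two]

theorem exists_ofAngles {N : ℕ} {X : Config N 2} (hX : IsUnitNorm X) :
    ∃ θ : Fin N → ℝ, X = ofAngles θ := by
  have h : ∀ k, ∃ t : ℝ, X k = !₂[Real.cos t, Real.sin t] := by
    intro k
    have hk := hX k
    rw [EuclideanSpace.norm_eq, Real.sqrt_eq_one] at hk
    simp only [Fin.sum_univ_two, Real.norm_eq_abs, sq_abs] at hk
    set z : ℂ := ⟨X k 0, X k 1⟩ with hz
    have hn : ‖z‖ = 1 := by
      rw [Complex.norm_def, Complex.normSq_mk, Real.sqrt_eq_one]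
      linarith
    refine ⟨z.arg, ?_⟩
    have hc := Complex.norm_mul_cos_arg z
    have hs := Complex.norm_mul_sin_arg z
    rw [hn, one_mul] at hc hs
    rw [hc, hs]
    ext i
    fin_cases i <;> simp [hz]
  choose θ hθ using h
  exact ⟨θ, funext hθ⟩

theorem halfCircle_eq_ofAngles (N : ℕ) :
    halfCircle N = ofAngles fun k : Fin N => (k : ℕ) * Real.pi / N := rfl

theorem potential_ofAngles {N : ℕ} (p : ℝ) (θ : Fin N → ℝ) :
    potential p (ofAngles θ)
      = ∑ k, ∑ l ∈ Finset.univ.erase k, |Real.cos (θ k - θ l)| ^ p := by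
  refine Finset.sum_congr rfl fun k _ => Finset.sum_congr rfl fun l _ => ?_
  congr 2
  rw [Real.cos_sub]
  simp [ofAngles, PiLp.inner_apply, Fin.sum_univ_two]
  ring

/-- Rotation of the Euclidean plane. -/
noncomputable def planeRotation (α : ℝ) :
    EuclideanSpace ℝ (Fin 2) ≃ₗᵢ[ℝ] EuclideanSpace ℝ (Fin 2) :=
  Complex.orthonormalBasisOneI.repr.symm.trans
    ((rotation (Circle.exp α)).trans Complex.orthonormalBasisOneI.repr)

theorem planeRotation_apply (α β : ℝ) :
    planeRotation α !₂[Real.cos β, Real.sin β] = !₂[Real.cos (α + β), Real.sin (α + β)] := by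
  ext i
  fin_cases i <;>
  simp [planeRotation, Complex.orthonormalBasisOneI_repr_apply,
    Complex.orthonormalBasisOneI_repr_symm_apply, rotation_apply, Circle.coe_exp, Real.cos_add,
    Real.sin_add, Complex.exp_ofReal_mul_I_re, Complex.exp_ofReal_mul_I_im,
    Complex.cos_ofReal_re, Complex.sin_ofReal_re]
  ring

/-- `N` lines whose pairwise angles are nonzero multiples of `π / N` modulo `π` are the equally
spaced lines up to a rotation: their positions exhaust the residues modulo `N`. -/
theorem equivalent_halfCircle {N : ℕ} (hN : 0 < N) {θ : Fin N → ℝ}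
    (h : ∀ k l, k ≠ l → ∃ i : ℤ, ¬ (N : ℤ) ∣ i ∧ θ k - θ l = i * Real.pi / N) :
    Equivalent (halfCircle N) (ofAngles θ) := by
  have hNr : (N : ℝ) ≠ 0 := by exact_mod_cast hN.ne'
  have hNz : (0 : ℤ) < N := by exact_mod_cast hN
  have h0 : ∀ k, ∃ i : ℤ, θ k = θ ⟨0, hN⟩ + i * Real.pi / N := by
    intro k
    by_cases hk : k = ⟨0, hN⟩
    · exact ⟨0, by simp [hk]⟩
    · obtain ⟨i, -, hi⟩ := h k _ hk
      exact ⟨i, by linarith⟩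
  choose n hn using h0
  have hmod : ∀ k, ((n k % N).toNat : ℤ) = n k % N := fun k =>
    Int.toNat_of_nonneg (Int.emod_nonneg _ hNz.ne')
  have hlt : ∀ k, (n k % N).toNat < N := by
    intro k
    have := Int.emod_lt_of_pos (n k) hNz
    have := hmod k
    omega
  set f : Fin N → Fin N := fun k => ⟨(n k % N).toNat, hlt k⟩ with hf
  have hinj : Function.Injective f := by
    intro k l hkl
    by_contra hne
    obtain ⟨i, hi, hie⟩ := h k l hne
    have h1 : (n k - n l : ℝ) = i := by
      rw [hn k, hn l] at hie
      field_simp at hie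
      have := mul_right_cancel₀ Real.pi_ne_zero
        (show (n k - n l : ℝ) * Real.pi = i * Real.pi by linarith)
      exact this
    have h2 : n k - n l = i := by exact_mod_cast h1
    have h3 : n k % N = n l % N := by
      rw [← hmod k, ← hmod l]
      exact_mod_cast congrArg Fin.val hkl
    exact hi (h2 ▸ Int.dvd_of_emod_eq_zero (Int.emod_eq_emod_iff_emod_sub_eq_zero.1 h3))
  refine ⟨planeRotation (θ ⟨0, hN⟩), Equiv.ofBijective f (Finite.injective_iff_bijective.1 hinj),
    fun k => (-1 : ℝ) ^ (n k / (N : ℤ)), fun k => ?_, fun k => ?_⟩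
  · rcases Int.even_or_odd (n k / (N : ℤ)) with he | ho
    · exact Or.inl he.neg_one_zpow
    · exact Or.inr ho.neg_one_zpow
  · have hθ : θ k = θ ⟨0, hN⟩ + ((f k : ℕ) : ℝ) * Real.pi / N
        + ((n k / (N : ℤ) : ℤ) : ℝ) * Real.pi := by
      have h1 : ((f k : ℕ) : ℝ) = ((n k % N : ℤ) : ℝ) := by
        exact_mod_cast congrArg (Int.cast : ℤ → ℝ) (hmod k)
      have h2 : (n k : ℝ) = N * ((n k / N : ℤ) : ℝ) + ((n k % N : ℤ) : ℝ) := by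
        exact_mod_cast congrArg (Int.cast : ℤ → ℝ) (Int.mul_ediv_add_emod (n k) N).symm
      rw [hn k, h1, h2]
      field_simp
      ring
    rw [Equiv.ofBijective_apply]
    simp only [halfCircle]
    rw [planeRotation_apply]
    simp only [ofAngles]
    rw [hθ, Real.cos_add_int_mul_pi, Real.sin_add_int_mul_pi]
    ext i
    fin_cases i <;> simp

/-- With at least three lines, orthogonality of a pair need not be listed separately. -/
theorem grid_of_grid_or_cos_eq_zero {N : ℕ} (hN : 3 ≤ N) {θ : Fin N → ℝ}
    (h : ∀ k l, k ≠ l → Real.cos (θ k - θ l) = 0 ∨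
      ∃ i : ℤ, ¬ (N : ℤ) ∣ i ∧ θ k - θ l = i * Real.pi / N) {k l : Fin N} (hkl : k ≠ l) :
    ∃ i : ℤ, ¬ (N : ℤ) ∣ i ∧ θ k - θ l = i * Real.pi / N := by
  have hNr : (N : ℝ) ≠ 0 := by exact_mod_cast (by omega : N ≠ 0)
  refine (h k l hkl).elim (fun hc => ?_) id
  obtain ⟨j, hj⟩ := Real.cos_eq_zero_iff.1 hc
  rcases N.even_or_odd' with ⟨m, hm | hm⟩
  · refine ⟨m * (2 * j + 1), fun hd => ?_, ?_⟩
    · rw [hm] at hd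
      push_cast at hd
      have h2 : (2 : ℤ) ∣ 2 * j + 1 := by
        refine Int.dvd_of_mul_dvd_mul_left (a := m) (by omega) ?_
        rwa [mul_comm (m : ℤ) 2]
      omega
    · rw [hj, hm]
      have : (m : ℝ) ≠ 0 := by exact_mod_cast (by omega : m ≠ 0)
      push_cast
      field_simp
  · -- For odd `N` an orthogonal pair contradicts the position of any third line.
    exfalso
    obtain ⟨q, hq⟩ := ({k, l}ᶜ : Finset (Fin N)).card_pos.1 (by
      rw [Finset.card_compl, Fintype.card_fin, Finset.card_pair hkl]; omega)
    simp only [Finset.mem_compl, Finset.mem_insert, Finset.mem_singleton, not_or] at hq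
    have hmul : ∀ (i c : ℤ) (x : ℝ), ¬ (N : ℤ) ∣ i → x = i * Real.pi / N → x = c * Real.pi →
        False := by
      intro i c x hi h1 h2
      rw [h1] at h2
      field_simp at h2
      have h3 : (i : ℝ) = N * c := by linarith
      exact hi ⟨c, by exact_mod_cast h3⟩
    have hodd : ∀ a b c : ℤ, (2 * a + 1 : ℝ) * Real.pi / 2 + (2 * b + 1) * Real.pi / 2
        = (2 * c + 1) * Real.pi / 2 → False := by
      intro a b c hab
      have h1 := mul_right_cancel₀ Real.pi_ne_zero
        (show (2 * a + 1 + (2 * b + 1) : ℝ) * Real.pi = (2 * c + 1) * Real.pi by linarith)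
      have h2 : 2 * a + 1 + (2 * b + 1) = 2 * c + 1 := by exact_mod_cast h1
      omega
    have hsum : θ k - θ q + (θ q - θ l) = θ k - θ l := by ring
    rcases h k q (Ne.symm hq.1) with h1 | ⟨i, hi, h1⟩ <;> rcases h q l hq.2 with h2 | ⟨i', hi', h2⟩
    · obtain ⟨a, ha⟩ := Real.cos_eq_zero_iff.1 h1
      obtain ⟨b, hb⟩ := Real.cos_eq_zero_iff.1 h2
      rw [ha, hb, hj] at hsum
      exact hodd a b j hsum
    · obtain ⟨a, ha⟩ := Real.cos_eq_zero_iff.1 h1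
      exact hmul i' (j - a) _ hi' h2 (by rw [ha, hj] at hsum; push_cast; linarith)
    · obtain ⟨b, hb⟩ := Real.cos_eq_zero_iff.1 h2
      exact hmul i (j - b) _ hi h1 (by rw [hb, hj] at hsum; push_cast; linarith)
    · rw [h1, h2, hj] at hsum
      field_simp at hsum
      have h3 : (2 * (i + i') : ℝ) = N * (2 * j + 1) := by linarith
      have h4 : 2 * (i + i') = (N : ℤ) * (2 * j + 1) := by exact_mod_cast h3
      have h5 : 2 * (i + i') = 2 * (m * (2 * j + 1) + j) + 1 := by
        rw [h4, hm]; push_cast; ring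
      omega

theorem sum_sum_erase {ι : Type*} [Fintype ι] [DecidableEq ι] (h : ℝ → ℝ) (θ : ι → ℝ) :
    ∑ k, ∑ l ∈ Finset.univ.erase k, h (θ k - θ l)
      = ∑ k, ∑ l, h (θ k - θ l) - Fintype.card ι * h 0 := by
  have : ∀ k, ∑ l ∈ Finset.univ.erase k, h (θ k - θ l) = ∑ l, h (θ k - θ l) - h 0 := by
    intro k
    rw [Finset.sum_erase_eq_sub (Finset.mem_univ k), sub_self]
  simp [this, Finset.sum_sub_distrib]

/-- Optimality of the equally spaced lines when the relevant derivatives of `(1 + t) ^ (s - n₀)`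
are nonnegative; here `n₀` is `1` or `0` according as `N` is even or odd. If moreover the last of
these derivatives is positive, the optimal configuration is unique. -/
theorem isOptimal_halfCircle {N n₀ M : ℕ} (hn₀ : n₀ ≤ 1) (hN : n₀ + 2 * M + 1 = N) (hN3 : 3 ≤ N)
    {p s : ℝ} (hp : p = 2 * s) (hs : 0 < s)
    (hprod : ∀ k ≤ 2 * M, 0 ≤ ∏ i ∈ Finset.range k, (s - n₀ - i)) :
    IsOptimal p (halfCircle N) ∧
      (0 < ∏ i ∈ Finset.range (2 * M), (s - n₀ - i) → IsUniqueOptimal p (halfCircle N)) := by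
  have hN0 : 0 < N := by omega
  have hNr : (N : ℝ) ≠ 0 := by exact_mod_cast hN0.ne'
  obtain ⟨h, hpd, hle, hzero, hstrict⟩ := exists_minorant hn₀ hN hs hprod
  rw [← hp] at hle hzero hstrict
  have hhalf : potential p (halfCircle N) = ∑ k : Fin N, ∑ l ∈ Finset.univ.erase k,
      h ((k : ℕ) * Real.pi / N - (l : ℕ) * Real.pi / N) := by
    rw [halfCircle_eq_ofAngles, potential_ofAngles]
    refine Finset.sum_congr rfl fun k _ => Finset.sum_congr rfl fun l hl => ?_
    refine (hzero _ ((centeredProd_eq_zero_iff hN0 _).2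
      ⟨(k : ℕ) - (l : ℕ), fun hd => ?_, ?_⟩)).symm
    · have h1 := Int.eq_zero_of_abs_lt_dvd hd (by
        have := k.2
        have := l.2
        rw [abs_lt]; omega)
      exact (Finset.mem_erase.1 hl).1 (Fin.ext (by omega))
    · push_cast
      ring
  have hbound : ∀ θ : Fin N → ℝ, potential p (halfCircle N)
      ≤ ∑ k, ∑ l ∈ Finset.univ.erase k, h (θ k - θ l) := by
    intro θ
    rw [hhalf, sum_sum_erase h θ, sum_sum_erase h fun k : Fin N => (k : ℕ) * Real.pi / N]
    exact sub_le_sub_right (hpd θ) _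
  have hlower : ∀ θ : Fin N → ℝ, ∑ k, ∑ l ∈ Finset.univ.erase k, h (θ k - θ l)
      ≤ potential p (ofAngles θ) := by
    intro θ
    rw [potential_ofAngles]
    exact Finset.sum_le_sum fun k _ => Finset.sum_le_sum fun l _ => hle _
  have hopt : IsOptimal p (halfCircle N) := by
    refine ⟨isUnitNorm_ofAngles _, fun Y hY => ?_⟩
    obtain ⟨θ, rfl⟩ := exists_ofAngles hY
    exact (hbound θ).trans (hlower θ)
  refine ⟨hopt, fun hlast => ⟨hopt, fun Y hY => ?_⟩⟩
  obtain ⟨θ, rfl⟩ := exists_ofAngles hY.1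
  have heq : ∑ k, ∑ l ∈ Finset.univ.erase k, h (θ k - θ l)
      = ∑ k, ∑ l ∈ Finset.univ.erase k, |Real.cos (θ k - θ l)| ^ p := by
    refine le_antisymm ((hlower θ).trans_eq (potential_ofAngles p θ)) ?_
    rw [← potential_ofAngles]
    exact (hY.2 _ hopt.1).trans (hbound θ)
  have heach : ∀ k l, k ≠ l → h (θ k - θ l) = |Real.cos (θ k - θ l)| ^ p := by
    intro k l hkl
    have h1 := (Finset.sum_eq_sum_iff_of_le fun k _ => Finset.sum_le_sum fun l _ => hle _).1 heq k
      (Finset.mem_univ k)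
    exact (Finset.sum_eq_sum_iff_of_le fun l _ => hle _).1 h1 l
      (Finset.mem_erase.2 ⟨hkl.symm, Finset.mem_univ l⟩)
  refine equivalent_halfCircle hN0 fun k l hkl => grid_of_grid_or_cos_eq_zero hN3 (θ := θ)
    (fun k l hkl => ?_) hkl
  rw [or_iff_not_imp_left]
  exact fun hc => (centeredProd_eq_zero_iff hN0 _).1 (hstrict hlast _ hc (heach k l hkl))

/-- The parity of `N` decides whether `-1` is an inner product of the doubled configuration. -/
theorem exists_parity_decomposition {N : ℕ} (hN : 0 < N) :
    ∃ n₀ M : ℕ, n₀ ≤ 1 ∧ n₀ + 2 * M + 1 = N :=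
  ⟨(N - 1) % 2, (N - 1) / 2, by omega, by omega⟩

theorem isUniqueOptimal_halfCircle_of_lt {N : ℕ} (hN : 3 ≤ N) {p : ℝ} (hp : 2 * (N : ℝ) - 4 < p) :
    IsUniqueOptimal p (halfCircle N) := by
  obtain ⟨n₀, M, hn₀, hM⟩ := exists_parity_decomposition (by omega : 0 < N)
  have hN' : (3 : ℝ) ≤ N := by exact_mod_cast hN
  have hpos : ∀ k ≤ 2 * M, 0 < ∏ i ∈ Finset.range k, (p / 2 - n₀ - i) := by
    intro k hk
    refine Finset.prod_pos fun i hi => ?_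
    have h1 : n₀ + i + 2 ≤ N := by have := Finset.mem_range.1 hi; omega
    have h2 : (n₀ : ℝ) + i + 2 ≤ N := by exact_mod_cast h1
    linarith
  exact (isOptimal_halfCircle hn₀ hM hN (by ring) (by linarith) fun k hk => (hpos k hk).le).2
    (hpos _ le_rfl)

theorem isOptimal_halfCircle_of_even {N n : ℕ} (hN : 3 ≤ N) (hn : Even n) (hn2 : 2 ≤ n) :
    IsOptimal (n : ℝ) (halfCircle N) := by
  obtain ⟨n₀, M, hn₀, hM⟩ := exists_parity_decomposition (by omega : 0 < N)
  obtain ⟨m, rfl⟩ := hn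
  refine (isOptimal_halfCircle (s := m) hn₀ hM hN (by push_cast; ring)
    (by exact_mod_cast (by omega : 0 < m)) fun k _ => ?_).1
  rcases le_or_gt k (m - n₀) with hk | hk
  · refine Finset.prod_nonneg fun i hi => ?_
    have h1 : n₀ + i ≤ m := by have := Finset.mem_range.1 hi; omega
    have h2 : (n₀ : ℝ) + i ≤ m := by exact_mod_cast h1
    linarith
  · refine (Finset.prod_eq_zero (Finset.mem_range.2 hk) ?_).ge
    rw [Nat.cast_sub (by omega)]
    ring

/-! ### An inequality for four lines -/

theorem cubic_pos {μ y : ℝ} (hμ : 0 < μ) (hy : 0 ≤ y) (hy1 : y ≤ 1 - μ) (hy2 : y * (2 - μ) ≤ μ) :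
    0 < μ ^ 2 * (μ - y * (2 - μ)) + μ ^ 2 * y * (μ / 4 * (1 - μ))
      + y ^ 2 * (1 - 2 * μ + μ ^ 2 / 4) + (1 - μ / 2) ^ 2 * y ^ 3 := by
  rcases le_total μ (1 / 2) with h | h
  · rcases hy.eq_or_lt with rfl | hy
    · have := pow_pos hμ 3
      nlinarith
    · have h1 : 0 ≤ μ ^ 2 * (μ - y * (2 - μ)) := mul_nonneg (sq_nonneg _) (by linarith)
      have h2 : 0 ≤ μ ^ 2 * y * (μ / 4 * (1 - μ)) :=
        mul_nonneg (by positivity) (mul_nonneg (by positivity) (by linarith))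
      have h3 : 0 ≤ y ^ 2 * (1 - 2 * μ + μ ^ 2 / 4) :=
        mul_nonneg (sq_nonneg _) (add_nonneg (by linarith) (by positivity))
      have h4 : 0 < (1 - μ / 2) ^ 2 * y ^ 3 := mul_pos (pow_pos (by linarith) 2) (pow_pos hy 3)
      linarith
  · have h1 := sub_nonneg.2 hy1
    have h2 := sub_nonneg.2 hy2
    rcases le_total y (2 / 5) with h' | h'
    · nlinarith [mul_nonneg hy h1, mul_nonneg h1 h2, mul_nonneg hy (mul_nonneg h1 h2),
        sq_nonneg (μ - 2 * y), sq_nonneg (μ - y)]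
    · nlinarith [mul_nonneg hy h1, mul_nonneg h1 h2, mul_nonneg hy (mul_nonneg h1 h2),
        sq_nonneg (μ - 2 * y), sq_nonneg (μ - y)]

/-- The polynomial inequality behind the four-line case. As a quadratic in `c` the left side is
positive when its discriminant is negative; otherwise it is decreasing on `[0, 1 - μ]`, and its
value at `1 - μ` is positive. -/
theorem quadratic_pos {μ c e : ℝ} (hμ : 0 < μ) (hc : 0 ≤ c) (hcμ : c ≤ 1 - μ) (he : 0 < e)
    (he1 : e ≤ 1) :
    0 < (μ + e * (1 - μ)) * (1 + e) * (e * c ^ 2 * (1 - μ / 2) ^ 2 - c * μ) + μ ^ 2 := by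
  have hδ : 0 ≤ 1 - μ := hc.trans hcμ
  set κ := (1 - μ / 2) ^ 2 with hκ
  set D := (μ + e * (1 - μ)) * (1 + e) with hD
  have hκ0 : 0 < κ := pow_pos (by linarith) 2
  have hD0 : 0 < D := by positivity
  rcases lt_or_ge D (4 * e * κ) with h | h
  · have h1 : 4 * e * κ * (D * (e * c ^ 2 * κ - c * μ) + μ ^ 2)
        = D * (2 * e * κ * c - μ) ^ 2 + μ ^ 2 * (4 * e * κ - D) := by ring
    have h2 : 0 < μ ^ 2 * (4 * e * κ - D) := mul_pos (by positivity) (sub_pos.2 h)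
    have h3 : 0 ≤ D * (2 * e * κ * c - μ) ^ 2 := by positivity
    have h4 : 0 < 4 * e * κ * (D * (e * c ^ 2 * κ - c * μ) + μ ^ 2) := by rw [h1]; linarith
    exact pos_of_mul_pos_right h4 (by positivity)
  · have h1 : e * (1 - μ) * (2 - μ) ≤ μ := by
      have : e * (1 - μ) * (2 - μ) ≤ e * (1 - μ) * (3 - μ - e) := by
        refine mul_le_mul_of_nonneg_left (by linarith) (by positivity)
      nlinarith
    have h2 : 2 * e * κ * (1 - μ) ≤ μ := by
      have : 2 * κ ≤ 2 - μ := by rw [hκ]; nlinarith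
      have := mul_le_mul_of_nonneg_left this (mul_nonneg he.le hδ)
      nlinarith
    have h3 : e * (1 - μ) ^ 2 * κ - (1 - μ) * μ ≤ e * c ^ 2 * κ - c * μ := by
      have : e * κ * (c + (1 - μ)) ≤ e * κ * (2 * (1 - μ)) :=
        mul_le_mul_of_nonneg_left (by linarith) (by positivity)
      nlinarith
    have h4 : 0 < D * (e * (1 - μ) ^ 2 * κ - (1 - μ) * μ) + μ ^ 2 := by
      set y := e * (1 - μ) with hy
      have hy0 : 0 ≤ y := by positivity
      have hy1 : y ≤ 1 - μ := mul_le_of_le_one_left hδ he1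
      have hy2 : y * (2 - μ) ≤ μ := h1
      have hS : D * (e * (1 - μ) ^ 2 * κ - (1 - μ) * μ) + μ ^ 2
          = μ ^ 2 * (μ - y * (2 - μ)) + μ ^ 2 * y * (μ / 4 * (1 - μ))
            + y ^ 2 * (1 - 2 * μ + μ ^ 2 / 4) + κ * y ^ 3 := by
        rw [hD, hκ, hy]; ring
      rw [hS, hκ]
      exact cubic_pos hμ hy0 hy1 hy2
    exact h4.trans_le (by nlinarith [mul_le_mul_of_nonneg_left h3 hD0.le])

/-- Bernoulli's inequality with base point `y`. -/
theorem rpow_sub_mul_le_rpow {y w s : ℝ} (hy : 0 < y) (hw : w ≤ y) (hs : 1 ≤ s) :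
    y ^ s - s * w * y ^ (s - 1) ≤ (y - w) ^ s := by
  have h1 : -1 ≤ -w / y := by
    rw [le_div_iff₀ hy]
    linarith
  have h2 := mul_le_mul_of_nonneg_left (one_add_mul_self_le_rpow_one_add h1 hs)
    (Real.rpow_nonneg hy.le s)
  rw [← Real.mul_rpow hy.le (by linarith)] at h2
  have h3 : y * (1 + -w / y) = y - w := by field_simp; ring
  have h4 : y ^ s = y ^ (s - 1) * y := by
    rw [← Real.rpow_add_one hy.ne', sub_add_cancel]
  have h5 : y ^ s * (1 + s * (-w / y)) = y ^ s - s * w * y ^ (s - 1) := by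
    rw [h4]; field_simp; ring
  rwa [h3, h5] at h2

/-- Midpoint convexity of `u ↦ u ^ s`. -/
theorem two_mul_rpow_half_add_le {u v s : ℝ} (hu : 0 ≤ u) (hv : 0 ≤ v) (hs : 1 ≤ s) :
    2 * ((u + v) / 2) ^ s ≤ u ^ s + v ^ s := by
  have h := (convexOn_rpow hs).2 (Set.mem_Ici.2 hu) (Set.mem_Ici.2 hv)
    (by norm_num : (0 : ℝ) ≤ 1 / 2) (by norm_num : (0 : ℝ) ≤ 1 / 2) (by norm_num)
  simp only [smul_eq_mul] at h
  rw [show (1 / 2 : ℝ) * u + 1 / 2 * v = (u + v) / 2 by ring] at h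
  linarith

theorem two_le_rpow_neg_add {x d : ℝ} (hx : |x| < 1) (hd : 0 ≤ d) (hd1 : d ≤ 1) :
    2 ≤ (1 + x) ^ (-d) + (1 - x) ^ (-d) := by
  obtain ⟨h1, h2⟩ := abs_lt.1 hx
  have hp : 0 < 1 + x := by linarith
  have hm : 0 < 1 - x := by linarith
  have e1 : (1 + x) ^ d ≤ 1 + d * x := rpow_one_add_le_one_add_mul_self h1.le hd hd1
  have e2 : (1 - x) ^ d ≤ 1 - d * x := by
    have := rpow_one_add_le_one_add_mul_self (s := -x) (by linarith) hd hd1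
    rwa [← sub_eq_add_neg, mul_neg, ← sub_eq_add_neg] at this
  have q1 := Real.rpow_pos_of_pos hp d
  have q2 := Real.rpow_pos_of_pos hm d
  rw [Real.rpow_neg hp.le, Real.rpow_neg hm.le]
  have f1 := inv_anti₀ q1 e1
  have f2 := inv_anti₀ q2 e2
  have g1 : 0 < 1 + d * x := q1.trans_le e1
  have g2 : 0 < 1 - d * x := q2.trans_le e2
  have f3 : 2 ≤ (1 + d * x)⁻¹ + (1 - d * x)⁻¹ := by
    rw [← sub_nonneg]
    have : (1 + d * x)⁻¹ + (1 - d * x)⁻¹ - 2 = 2 * (d * x) ^ 2 / ((1 + d * x) * (1 - d * x)) := by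
      field_simp
      ring
    rw [this]
    positivity
  linarith

theorem two_mul_le_rpow_sub_rpow {x e : ℝ} (hx : 0 ≤ x) (hx1 : x < 1) (he : 0 ≤ e) (he1 : e ≤ 1) :
    2 * e * x ≤ (1 + x) ^ e - (1 - x) ^ e := by
  have hd : ∀ u ∈ Set.Ico (0 : ℝ) 1, HasDerivAt
      (fun u : ℝ => (1 + u) ^ e - (1 - u) ^ e - 2 * e * u)
      (e * ((1 + u) ^ (-(1 - e)) + (1 - u) ^ (-(1 - e)) - 2)) u := by
    intro u hu
    have hp : (1 + u) ≠ 0 := by linarith [hu.1]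
    have hm : (1 - u) ≠ 0 := by linarith [hu.2]
    have h1 := ((hasDerivAt_id u).const_add 1).rpow_const (p := e) (Or.inl hp)
    have h2 := ((hasDerivAt_id u).const_sub 1).rpow_const (p := e) (Or.inl hm)
    have h3 := (h1.sub h2).sub ((hasDerivAt_id u).const_mul (2 * e))
    refine h3.congr_deriv ?_
    rw [neg_sub]
    simp only [id]
    ring
  have hmono : MonotoneOn (fun u : ℝ => (1 + u) ^ e - (1 - u) ^ e - 2 * e * u) (Set.Ico 0 1) := by
    refine monotoneOn_of_deriv_nonneg (convex_Ico 0 1)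
      (fun u hu => (hd u hu).continuousAt.continuousWithinAt)
      (fun u hu => (hd u (interior_subset hu)).differentiableAt.differentiableWithinAt)
      (fun u hu => ?_)
    have hu := interior_subset hu
    rw [(hd u hu).deriv]
    exact mul_nonneg he (sub_nonneg.2 (two_le_rpow_neg_add
      (abs_lt.2 ⟨by linarith [hu.1], hu.2⟩) (by linarith) (by linarith)))
  have h := hmono ⟨le_rfl, one_pos⟩ ⟨hx, hx1⟩ hx
  simp only [add_zero, sub_zero, mul_zero, sub_self] at h
  linarith

/-- Second-order lower bound at `0` for the even part of `(1 + x) ^ s`, valid on all of `(-1, 1)`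
because `s = 1 + e` lies in `[1, 2]`. The two preceding lemmas are the corresponding statements
for its first two derivatives. -/
theorem two_add_le_rpow_add_rpow {x e : ℝ} (hx : |x| < 1) (he : 0 ≤ e) (he1 : e ≤ 1) :
    2 + (1 + e) * e * x ^ 2 ≤ (1 + x) ^ (1 + e) + (1 - x) ^ (1 + e) := by
  have hd : ∀ u ∈ Set.Ico (0 : ℝ) 1, HasDerivAt
      (fun u : ℝ => (1 + u) ^ (1 + e) + (1 - u) ^ (1 + e) - (1 + e) * e * u ^ 2)
      ((1 + e) * ((1 + u) ^ e - (1 - u) ^ e - 2 * e * u)) u := by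
    intro u hu
    have hp : (1 + u) ≠ 0 := by linarith [hu.1]
    have hm : (1 - u) ≠ 0 := by linarith [hu.2]
    have h1 := ((hasDerivAt_id u).const_add 1).rpow_const (p := 1 + e) (Or.inl hp)
    have h2 := ((hasDerivAt_id u).const_sub 1).rpow_const (p := 1 + e) (Or.inl hm)
    have h3 := (h1.add h2).sub (((hasDerivAt_id u).pow 2).const_mul ((1 + e) * e))
    refine h3.congr_deriv ?_
    rw [add_sub_cancel_left]
    simp only [id]
    push_cast
    ring
  have hmono : MonotoneOn
      (fun u : ℝ => (1 + u) ^ (1 + e) + (1 - u) ^ (1 + e) - (1 + e) * e * u ^ 2)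
      (Set.Ico 0 1) := by
    refine monotoneOn_of_deriv_nonneg (convex_Ico 0 1)
      (fun u hu => (hd u hu).continuousAt.continuousWithinAt)
      (fun u hu => (hd u (interior_subset hu)).differentiableAt.differentiableWithinAt)
      (fun u hu => ?_)
    have hu := interior_subset hu
    rw [(hd u hu).deriv]
    exact mul_nonneg (by linarith) (sub_nonneg.2 (two_mul_le_rpow_sub_rpow hu.1 hu.2 he he1))
  have h := hmono ⟨le_rfl, one_pos⟩ ⟨abs_nonneg x, hx⟩ (abs_nonneg x)
  simp only [add_zero, sub_zero, Real.one_rpow, sq_abs] at h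
  rcases abs_choice x with hx' | hx' <;> rw [hx'] at h
  · norm_num at h
    linarith
  · rw [← sub_eq_add_neg, sub_neg_eq_add] at h
    norm_num at h
    linarith

/-- The four-line inequality in the variables `1 + cos`. Four lines are split into two pairs; `2 A`
and `2 B` belong to the pairs, the `uᵢ` to the lines of different pairs. The hypotheses `h₁`, `h₂`
say that the splitting makes `A + B` smallest among the three splittings. The inequality is
strict unless both pairs are orthogonal and the `uᵢ` are all `1`. -/
theorem four_le_sum_rpow {e A B c x w u₁ u₂ u₃ u₄ : ℝ} (he : 0 < e) (he1 : e ≤ 1)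
    (hA : 0 ≤ A) (hB : 0 ≤ B)
    (hx : x ^ 2 = c ^ 2 * ((1 - A) * (1 - B))) (hw : w ^ 2 = c ^ 2 * (A * B))
    (hu₁ : 0 ≤ u₁) (hu₂ : 0 ≤ u₂) (hu₃ : 0 ≤ u₃) (hu₄ : 0 ≤ u₄)
    (h₁₂ : u₁ + u₂ = 2 * (1 + x - w)) (h₃₄ : u₃ + u₄ = 2 * (1 - x - w))
    (h₁ : A + B ≤ 1 + x - w) (h₂ : A + B ≤ 1 - x - w) :
    4 ≤ u₁ ^ (1 + e) + u₂ ^ (1 + e) + (u₃ ^ (1 + e) + u₄ ^ (1 + e))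
        + ((2 * A) ^ (1 + e) + (2 * B) ^ (1 + e)) ∧
    (u₁ ^ (1 + e) + u₂ ^ (1 + e) + (u₃ ^ (1 + e) + u₄ ^ (1 + e))
        + ((2 * A) ^ (1 + e) + (2 * B) ^ (1 + e)) = 4 →
      A = 0 ∧ B = 0 ∧ u₁ = 1 ∧ u₂ = 1 ∧ u₃ = 1 ∧ u₄ = 1) := by
  have hs : 1 < 1 + e := by linarith
  have hA' : 0 ≤ (2 * A) ^ (1 + e) := by positivity
  have hB' : 0 ≤ (2 * B) ^ (1 + e) := by positivity
  rcases le_or_gt w 0 with hw0 | hw0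
  · -- Bernoulli's inequality at the base point `1` suffices.
    have hb : ∀ u : ℝ, 0 ≤ u → 1 + (1 + e) * (u - 1) ≤ u ^ (1 + e) := by
      intro u hu
      have := one_add_mul_self_le_rpow_one_add (s := u - 1) (by linarith) hs.le
      rwa [add_sub_cancel] at this
    have hb' : ∀ u : ℝ, 0 ≤ u → u ≠ 1 → 1 + (1 + e) * (u - 1) < u ^ (1 + e) := by
      intro u hu hu1
      have := one_add_mul_self_lt_rpow_one_add (s := u - 1) (by linarith) (sub_ne_zero.2 hu1) hs
      rwa [add_sub_cancel] at this
    have hsum : 0 ≤ (1 + e) * (u₁ - 1) + (1 + e) * (u₂ - 1) + (1 + e) * (u₃ - 1)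
        + (1 + e) * (u₄ - 1) := by
      have : (1 + e) * (u₁ - 1) + (1 + e) * (u₂ - 1) + (1 + e) * (u₃ - 1) + (1 + e) * (u₄ - 1)
          = (1 + e) * (-4 * w) := by linear_combination (1 + e) * (h₁₂ + h₃₄)
      rw [this]
      exact mul_nonneg (by linarith) (by linarith)
    have b1 := hb u₁ hu₁
    have b2 := hb u₂ hu₂
    have b3 := hb u₃ hu₃
    have b4 := hb u₄ hu₄
    refine ⟨by linarith, fun heq => ⟨?_, ?_, ?_, ?_, ?_, ?_⟩⟩
    · by_contra h
      have : 0 < (2 * A) ^ (1 + e) := by have := hA.lt_of_ne' h; positivity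
      linarith
    · by_contra h
      have : 0 < (2 * B) ^ (1 + e) := by have := hB.lt_of_ne' h; positivity
      linarith
    · by_contra h
      linarith [hb' u₁ hu₁ h]
    · by_contra h
      linarith [hb' u₂ hu₂ h]
    · by_contra h
      linarith [hb' u₃ hu₃ h]
    · by_contra h
      linarith [hb' u₄ hu₄ h]
  · -- Here the inequality is strict.
    suffices h : 4 < u₁ ^ (1 + e) + u₂ ^ (1 + e) + (u₃ ^ (1 + e) + u₄ ^ (1 + e))
        + ((2 * A) ^ (1 + e) + (2 * B) ^ (1 + e)) from ⟨h.le, fun heq => absurd heq h.ne'⟩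
    set μ := A + B with hμ
    have hAB : 0 ≤ A * B := mul_nonneg hA hB
    have hμ0 : 0 < μ := by
      refine (add_nonneg hA hB).lt_of_ne fun h => ?_
      have hA0 : A = 0 := by linarith
      rw [hA0, zero_mul, mul_zero] at hw
      exact hw0.ne' (pow_eq_zero_iff two_ne_zero |>.1 hw)
    have hxw : |x| ≤ 1 - μ - w := abs_le.2 ⟨by linarith, by linarith⟩
    have hx1 : |x| < 1 := by linarith
    obtain ⟨hx2, hx3⟩ := abs_lt.1 hx1
    have hμ1 : 0 < 1 - μ := by linarith [abs_nonneg x]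
    have k1 := two_mul_rpow_half_add_le hu₁ hu₂ hs.le
    have k2 := two_mul_rpow_half_add_le hu₃ hu₄ hs.le
    have k3 := two_mul_rpow_half_add_le (u := 2 * A) (v := 2 * B) (by linarith) (by linarith) hs.le
    rw [h₁₂, mul_div_cancel_left₀ _ two_ne_zero] at k1
    rw [h₃₄, mul_div_cancel_left₀ _ two_ne_zero] at k2
    rw [← mul_add, mul_div_cancel_left₀ _ two_ne_zero, ← hμ] at k3
    have k4 := rpow_sub_mul_le_rpow (y := 1 + x) (w := w) (by linarith) (by linarith) hs.le
    have k5 := rpow_sub_mul_le_rpow (y := 1 - x) (w := w) (by linarith) (by linarith) hs.le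
    rw [add_sub_cancel_left] at k4 k5
    have k6 : (1 + x) ^ e ≤ 1 + e * x := rpow_one_add_le_one_add_mul_self hx2.le he.le he1
    have k7 : (1 - x) ^ e ≤ 1 - e * x := by
      have := rpow_one_add_le_one_add_mul_self (s := -x) (by linarith) he.le he1
      rwa [← sub_eq_add_neg, mul_neg, ← sub_eq_add_neg] at this
    have k8 : (1 + e) * w * ((1 + x) ^ e + (1 - x) ^ e) ≤ (1 + e) * w * 2 :=
      mul_le_mul_of_nonneg_left (by linarith) (by positivity)
    have k9 := two_add_le_rpow_add_rpow hx1 he.le he1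
    -- In terms of `x`, `w` and `μ`, it remains to bound `(1 + e) e x² - 2 (1 + e) w + μ ^ (1 + e)` from below.
    set D := μ + e * (1 - μ) with hD
    have hD0 : 0 < D := by positivity
    have l1 : μ ^ 2 / D ≤ μ ^ (1 + e) := by
      have h := rpow_one_add_le_one_add_mul_self (s := μ⁻¹ - 1)
        (by linarith [inv_pos.2 hμ0]) he.le he1
      rw [add_sub_cancel, Real.inv_rpow hμ0.le] at h
      have hD' : 1 + e * (μ⁻¹ - 1) = D / μ := by rw [hD]; field_simp
      rw [hD'] at h
      have h' := inv_anti₀ (inv_pos.2 (Real.rpow_pos_of_pos hμ0 e)) h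
      rw [inv_inv, inv_div] at h'
      rw [Real.rpow_add hμ0, Real.rpow_one, sq, mul_div_assoc]
      exact mul_le_mul_of_nonneg_left h' hμ0.le
    -- The worst case is `A = B`; `C` is the value of `|c|` which gives the same `w` there.
    set C := 2 * w / μ with hC
    have hC0 : 0 < C := by positivity
    have hCw : w = C * μ / 2 := by rw [hC]; field_simp
    have hCc : C ^ 2 ≤ c ^ 2 := by
      have h4 : 4 * w ^ 2 ≤ c ^ 2 * μ ^ 2 := by
        rw [hw, hμ]
        nlinarith [mul_nonneg (sq_nonneg c) (sq_nonneg (A - B))]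
      rw [hC, div_pow, div_le_iff₀ (by positivity)]
      linarith
    have hxC : C ^ 2 * (1 - μ / 2) ^ 2 ≤ x ^ 2 := by
      have h5 : x ^ 2 = c ^ 2 * (1 - μ) + w ^ 2 := by rw [hx, hw, hμ]; ring
      have h6 : C ^ 2 * (1 - μ / 2) ^ 2 = C ^ 2 * (1 - μ) + w ^ 2 := by rw [hCw]; ring
      rw [h5, h6]
      exact add_le_add_left (mul_le_mul_of_nonneg_right hCc hμ1.le) _
    have hC1 : C ≤ 1 - μ := by
      have h6 : x ^ 2 ≤ (1 - μ - w) ^ 2 := by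
        rw [← sq_abs x]
        exact pow_le_pow_left₀ (abs_nonneg x) hxw 2
      have h7 : (1 - μ) * ((C + 1) * (1 - μ - C)) = (1 - μ - w) ^ 2 - C ^ 2 * (1 - μ / 2) ^ 2 := by
        rw [hCw]; ring
      have h8 : 0 ≤ (1 - μ) * ((C + 1) * (1 - μ - C)) := by rw [h7]; linarith
      have h9 := nonneg_of_mul_nonneg_right h8 hμ1
      linarith [nonneg_of_mul_nonneg_right h9 (by linarith : 0 < C + 1)]
    have hQ := quadratic_pos hμ0 hC0.le hC1 he he1
    rw [← hD] at hQ
    have hQ' : 0 < (1 + e) * (e * C ^ 2 * (1 - μ / 2) ^ 2 - C * μ) + μ ^ 2 / D := by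
      have h := div_pos hQ hD0
      have : (D * (1 + e) * (e * C ^ 2 * (1 - μ / 2) ^ 2 - C * μ) + μ ^ 2) / D
          = (1 + e) * (e * C ^ 2 * (1 - μ / 2) ^ 2 - C * μ) + μ ^ 2 / D := by
        field_simp
      rwa [this] at h
    have l2 := mul_le_mul_of_nonneg_left hxC (by positivity : 0 ≤ (1 + e) * e)
    have l3 : (1 + e) * w * 2 = (1 + e) * (C * μ) := by rw [hCw]; ring
    linarith

/-! ### Four lines -/

theorem abs_cos_rpow_two_mul (s ψ : ℝ) :
    |Real.cos ψ| ^ (2 * s) = (1 / 2 : ℝ) ^ s * (1 + Real.cos (2 * ψ)) ^ s := by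
  rw [Real.rpow_mul (abs_nonneg _), Real.rpow_two, sq_abs, Real.cos_sq,
    ← Real.mul_rpow (by norm_num) (by linarith [Real.neg_one_le_cos (2 * ψ)])]
  congr 1
  ring

/-- The four-line inequality for angles, when the splitting `{θ₁, θ₃}`, `{θ₂, θ₄}` is closest to a
pair of orthogonal pairs. -/
theorem four_lines {e θ₁ θ₂ θ₃ θ₄ : ℝ} (he : 0 < e) (he1 : e ≤ 1)
    (h₁ : Real.cos (2 * (θ₁ - θ₃)) + Real.cos (2 * (θ₂ - θ₄))
      ≤ Real.cos (2 * (θ₁ - θ₂)) + Real.cos (2 * (θ₃ - θ₄)))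
    (h₂ : Real.cos (2 * (θ₁ - θ₃)) + Real.cos (2 * (θ₂ - θ₄))
      ≤ Real.cos (2 * (θ₁ - θ₄)) + Real.cos (2 * (θ₂ - θ₃))) :
    4 * (1 / 2 : ℝ) ^ (1 + e) ≤
      |Real.cos (θ₁ - θ₂)| ^ (2 * (1 + e)) + |Real.cos (θ₃ - θ₄)| ^ (2 * (1 + e))
      + (|Real.cos (θ₁ - θ₄)| ^ (2 * (1 + e)) + |Real.cos (θ₂ - θ₃)| ^ (2 * (1 + e)))
      + (|Real.cos (θ₁ - θ₃)| ^ (2 * (1 + e)) + |Real.cos (θ₂ - θ₄)| ^ (2 * (1 + e))) ∧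
    (|Real.cos (θ₁ - θ₂)| ^ (2 * (1 + e)) + |Real.cos (θ₃ - θ₄)| ^ (2 * (1 + e))
      + (|Real.cos (θ₁ - θ₄)| ^ (2 * (1 + e)) + |Real.cos (θ₂ - θ₃)| ^ (2 * (1 + e)))
      + (|Real.cos (θ₁ - θ₃)| ^ (2 * (1 + e)) + |Real.cos (θ₂ - θ₄)| ^ (2 * (1 + e)))
        = 4 * (1 / 2 : ℝ) ^ (1 + e) →
      Real.cos (θ₁ - θ₃) = 0 ∧ Real.cos (θ₂ - θ₄) = 0 ∧
      Real.cos (2 * (θ₁ - θ₂)) = 0 ∧ Real.cos (2 * (θ₃ - θ₄)) = 0 ∧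
      Real.cos (2 * (θ₁ - θ₄)) = 0 ∧ Real.cos (2 * (θ₂ - θ₃)) = 0) := by
  set α := θ₁ - θ₃ with hα
  set β := θ₂ - θ₄ with hβ
  set γ := θ₁ + θ₃ - θ₂ - θ₄ with hγ
  have e12 : 2 * (θ₁ - θ₂) = γ + (α - β) := by rw [hα, hβ, hγ]; ring
  have e34 : 2 * (θ₃ - θ₄) = γ - (α - β) := by rw [hα, hβ, hγ]; ring
  have e14 : 2 * (θ₁ - θ₄) = γ + (α + β) := by rw [hα, hβ, hγ]; ring
  have e23 : 2 * (θ₂ - θ₃) = -(γ - (α + β)) := by rw [hα, hβ, hγ]; ring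
  have s1 : Real.cos (2 * (θ₁ - θ₂)) + Real.cos (2 * (θ₃ - θ₄))
      = 2 * (Real.cos γ * Real.sin α * Real.sin β - -(Real.cos γ * Real.cos α * Real.cos β)) := by
    rw [e12, e34, Real.cos_add, Real.cos_sub γ, Real.cos_sub α]; ring
  have s2 : Real.cos (2 * (θ₁ - θ₄)) + Real.cos (2 * (θ₂ - θ₃))
      = 2 * (-(Real.cos γ * Real.sin α * Real.sin β)
        - -(Real.cos γ * Real.cos α * Real.cos β)) := by
    rw [e14, e23, Real.cos_neg, Real.cos_add γ, Real.cos_sub γ, Real.cos_add α]; ring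
  rw [s1, Real.cos_two_mul, Real.cos_two_mul] at h₁
  rw [s2, Real.cos_two_mul, Real.cos_two_mul] at h₂
  have hu : ∀ y : ℝ, 0 ≤ 1 + Real.cos y := fun y => by linarith [Real.neg_one_le_cos y]
  obtain ⟨k1, k2⟩ := four_le_sum_rpow (c := Real.cos γ) (A := Real.cos α ^ 2)
    (B := Real.cos β ^ 2) (x := Real.cos γ * Real.sin α * Real.sin β)
    (w := -(Real.cos γ * Real.cos α * Real.cos β)) he he1 (sq_nonneg _) (sq_nonneg _)
    (by rw [← Real.sin_sq, ← Real.sin_sq]; ring) (by ring) (hu (2 * (θ₁ - θ₂)))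
    (hu (2 * (θ₃ - θ₄))) (hu (2 * (θ₁ - θ₄))) (hu (2 * (θ₂ - θ₃))) (by linarith) (by linarith)
    (by linarith) (by linarith)
  have hhalf : (0 : ℝ) < (1 / 2 : ℝ) ^ (1 + e) := by positivity
  have hα2 : 1 + Real.cos (2 * α) = 2 * Real.cos α ^ 2 := by rw [Real.cos_two_mul]; ring
  have hβ2 : 1 + Real.cos (2 * β) = 2 * Real.cos β ^ 2 := by rw [Real.cos_two_mul]; ring
  simp only [abs_cos_rpow_two_mul, ← mul_add, hα2, hβ2]
  rw [mul_comm (4 : ℝ)]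
  refine ⟨mul_le_mul_of_nonneg_left k1 hhalf.le, fun heq => ?_⟩
  obtain ⟨hA, hB, h12, h34, h14, h23⟩ := k2 (mul_left_cancel₀ hhalf.ne' heq)
  exact ⟨pow_eq_zero_iff two_ne_zero |>.1 hA, pow_eq_zero_iff two_ne_zero |>.1 hB,
    by linarith, by linarith, by linarith, by linarith⟩

theorem potential_ofAngles_four (p : ℝ) (θ : Fin 4 → ℝ) :
    potential p (ofAngles θ) = 2 *
      (|Real.cos (θ 0 - θ 1)| ^ p + |Real.cos (θ 2 - θ 3)| ^ p
      + (|Real.cos (θ 0 - θ 3)| ^ p + |Real.cos (θ 1 - θ 2)| ^ p)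
      + (|Real.cos (θ 0 - θ 2)| ^ p + |Real.cos (θ 1 - θ 3)| ^ p)) := by
  have hsymm : ∀ i j, |Real.cos (θ i - θ j)| ^ p = |Real.cos (θ j - θ i)| ^ p := fun i j => by
    rw [← Real.cos_neg, neg_sub]
  rw [potential_ofAngles, sum_sum_erase fun ψ => |Real.cos ψ| ^ p]
  simp only [Fin.sum_univ_four, sub_self, Real.cos_zero, abs_one, Real.one_rpow,
    Fintype.card_fin]
  rw [hsymm 1 0, hsymm 2 0, hsymm 3 0, hsymm 2 1, hsymm 3 1, hsymm 3 2]
  push_cast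
  ring

/-- Four lines always admit a splitting to which `four_lines` applies. -/
theorem four_lines_bound {e : ℝ} (he : 0 < e) (he1 : e ≤ 1) (θ : Fin 4 → ℝ) :
    8 * (1 / 2 : ℝ) ^ (1 + e) ≤ potential (2 * (1 + e)) (ofAngles θ) ∧
    (potential (2 * (1 + e)) (ofAngles θ) = 8 * (1 / 2 : ℝ) ^ (1 + e) →
      ∀ k l, k ≠ l → Real.cos (θ k - θ l) = 0 ∨ Real.cos (2 * (θ k - θ l)) = 0) := by
  have hV : ∀ i j, |Real.cos (θ i - θ j)| ^ (2 * (1 + e))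
      = |Real.cos (θ j - θ i)| ^ (2 * (1 + e)) := fun i j => by
    rw [← Real.cos_neg, neg_sub]
  have hT : ∀ i j, Real.cos (2 * (θ i - θ j)) = Real.cos (2 * (θ j - θ i)) := fun i j => by
    rw [← Real.cos_neg]
    congr 1
    ring
  have hC : ∀ i j, Real.cos (θ i - θ j) = Real.cos (θ j - θ i) := fun i j => by
    rw [← Real.cos_neg, neg_sub]
  rw [potential_ofAngles_four]
  -- It suffices to treat the six pairs with increasing labels.
  have hpairs : (Real.cos (θ 0 - θ 1) = 0 ∨ Real.cos (2 * (θ 0 - θ 1)) = 0) →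
      (Real.cos (θ 2 - θ 3) = 0 ∨ Real.cos (2 * (θ 2 - θ 3)) = 0) →
      (Real.cos (θ 0 - θ 3) = 0 ∨ Real.cos (2 * (θ 0 - θ 3)) = 0) →
      (Real.cos (θ 1 - θ 2) = 0 ∨ Real.cos (2 * (θ 1 - θ 2)) = 0) →
      (Real.cos (θ 0 - θ 2) = 0 ∨ Real.cos (2 * (θ 0 - θ 2)) = 0) →
      (Real.cos (θ 1 - θ 3) = 0 ∨ Real.cos (2 * (θ 1 - θ 3)) = 0) →
      ∀ k l, k ≠ l → Real.cos (θ k - θ l) = 0 ∨ Real.cos (2 * (θ k - θ l)) = 0 := by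
    intro h01 h23 h03 h12 h02 h13 k l hkl
    fin_cases k <;> fin_cases l <;> first
      | exact absurd rfl hkl
      | assumption
      | (rw [hC, hT]; assumption)
  set S₀ := Real.cos (2 * (θ 0 - θ 2)) + Real.cos (2 * (θ 1 - θ 3)) with hS₀
  set S₁ := Real.cos (2 * (θ 0 - θ 1)) + Real.cos (2 * (θ 2 - θ 3)) with hS₁
  set S₂ := Real.cos (2 * (θ 0 - θ 3)) + Real.cos (2 * (θ 1 - θ 2)) with hS₂
  have hmin : ∀ a b c : ℝ, (a ≤ b ∧ a ≤ c) ∨ (b ≤ a ∧ b ≤ c) ∨ (c ≤ a ∧ c ≤ b) := by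
    intro a b c
    grind
  rcases hmin S₀ S₁ S₂ with ⟨h1, h2⟩ | ⟨h1, h2⟩ | ⟨h1, h2⟩
  · obtain ⟨k1, k2⟩ := four_lines (θ₁ := θ 0) (θ₂ := θ 1) (θ₃ := θ 2) (θ₄ := θ 3) he he1 h1 h2
    refine ⟨by linarith, fun heq => ?_⟩
    obtain ⟨a, b, c, d, f, g⟩ := k2 (by linarith)
    exact hpairs (.inr c) (.inr d) (.inr f) (.inr g) (.inl a) (.inl b)
  · obtain ⟨k1, k2⟩ := four_lines (θ₁ := θ 0) (θ₂ := θ 2) (θ₃ := θ 1) (θ₄ := θ 3) he he1 h1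
      (by rw [hT 2 1]; exact h2)
    rw [hV 2 1] at k1 k2
    refine ⟨by linarith, fun heq => ?_⟩
    obtain ⟨a, b, c, d, f, g⟩ := k2 (by linarith)
    exact hpairs (.inl a) (.inl b) (.inr f) (.inr (hT 2 1 ▸ g)) (.inr c) (.inr d)
  · obtain ⟨k1, k2⟩ := four_lines (θ₁ := θ 0) (θ₂ := θ 1) (θ₃ := θ 3) (θ₄ := θ 2) he he1
      (by rw [hT 3 2]; exact h2) h1
    rw [hV 3 2] at k1 k2
    refine ⟨by linarith, fun heq => ?_⟩
    obtain ⟨a, b, c, d, f, g⟩ := k2 (by linarith)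
    exact hpairs (.inr c) (.inr (hT 3 2 ▸ d)) (.inl a) (.inl b) (.inr f) (.inr g)

theorem potential_halfCircle_four {e : ℝ} (he : 0 < e) :
    potential (2 * (1 + e)) (halfCircle 4) = 8 * (1 / 2 : ℝ) ^ (1 + e) := by
  have hadj : ∀ ψ : ℝ, Real.cos (2 * ψ) = 0 →
      |Real.cos ψ| ^ (2 * (1 + e)) = (1 / 2 : ℝ) ^ (1 + e) := fun ψ h => by
    rw [abs_cos_rpow_two_mul, h, add_zero, Real.one_rpow, mul_one]
  have hopp : ∀ ψ : ℝ, Real.cos (2 * ψ) = -1 → |Real.cos ψ| ^ (2 * (1 + e)) = 0 := fun ψ h => by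
    rw [abs_cos_rpow_two_mul, h, add_neg_cancel, Real.zero_rpow (by linarith), mul_zero]
  have h1 : ∀ ψ : ℝ, ψ = -(Real.pi / 4) → Real.cos (2 * ψ) = 0 := by
    rintro _ rfl
    rw [show 2 * -(Real.pi / 4) = -(Real.pi / 2) by ring, Real.cos_neg, Real.cos_pi_div_two]
  have h2 : ∀ ψ : ℝ, ψ = -(Real.pi / 2) → Real.cos (2 * ψ) = -1 := by
    rintro _ rfl
    rw [show 2 * -(Real.pi / 2) = -Real.pi by ring, Real.cos_neg, Real.cos_pi]
  have h3 : ∀ ψ : ℝ, ψ = -(3 * Real.pi / 4) → Real.cos (2 * ψ) = 0 := by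
    rintro _ rfl
    rw [show 2 * -(3 * Real.pi / 4) = -(Real.pi / 2 + Real.pi) by ring, Real.cos_neg,
      Real.cos_add_pi, Real.cos_pi_div_two, neg_zero]
  rw [halfCircle_eq_ofAngles, potential_ofAngles_four]
  rw [hadj _ (h1 _ ?_), hadj _ (h1 _ ?_), hadj _ (h3 _ ?_), hadj _ (h1 _ ?_), hopp _ (h2 _ ?_),
    hopp _ (h2 _ ?_)]
  · ring
  all_goals
    norm_num [Fin.val_two]
    try ring

theorem isUniqueOptimal_halfCircle_four {p : ℝ} (hp : 2 < p) :
    IsUniqueOptimal p (halfCircle 4) := by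
  rcases lt_or_ge 4 p with h | h
  · exact isUniqueOptimal_halfCircle_of_lt (by norm_num) (by push_cast; linarith)
  obtain ⟨e, rfl⟩ : ∃ e, p = 2 * (1 + e) := ⟨p / 2 - 1, by ring⟩
  have he : 0 < e := by linarith
  have he1 : e ≤ 1 := by linarith
  have hopt : IsOptimal (2 * (1 + e)) (halfCircle 4) := by
    refine ⟨isUnitNorm_ofAngles _, fun Y hY => ?_⟩
    obtain ⟨θ, rfl⟩ := exists_ofAngles hY
    rw [potential_halfCircle_four he]
    exact (four_lines_bound he he1 θ).1
  refine ⟨hopt, fun Y hY => ?_⟩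
  obtain ⟨θ, rfl⟩ := exists_ofAngles hY.1
  have hle := hY.2 _ hopt.1
  rw [potential_halfCircle_four he] at hle
  obtain ⟨k1, k2⟩ := four_lines_bound he he1 θ
  refine equivalent_halfCircle (by norm_num) fun k l hkl =>
    grid_of_grid_or_cos_eq_zero (by norm_num) (θ := θ) (fun k l hkl => ?_) hkl
  refine (k2 (le_antisymm hle k1) k l hkl).imp_right fun hc => ?_
  obtain ⟨j, hj⟩ := Real.cos_eq_zero_iff.1 hc
  refine ⟨2 * j + 1, by push_cast; omega, ?_⟩
  push_cast
  linarith

end FramePotential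

theorem theorem3p5 :
    (∀ p : ℝ, 2 < p →
      FramePotential.IsUniqueOptimal p (FramePotential.halfCircle 4)) ∧
    (∀ (N : ℕ) (p : ℝ), 5 ≤ N → FramePotential.threshold N < p →
      FramePotential.IsUniqueOptimal p (FramePotential.halfCircle N)) ∧
    (∀ (N n : ℕ), 5 ≤ N → Even n → 2 < n → (n : ℝ) ≤ FramePotential.threshold N →
      FramePotential.IsOptimal (n : ℝ) (FramePotential.halfCircle N)) := by
  refine ⟨fun p hp => FramePotential.isUniqueOptimal_halfCircle_four hp, fun N p hN hp => ?_,
    fun N n hN hn hn2 _ =>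
      FramePotential.isOptimal_halfCircle_of_even (by omega) hn hn2.le⟩
  refine FramePotential.isUniqueOptimal_halfCircle_of_lt (by omega) (lt_of_le_of_lt ?_ hp)
  unfold FramePotential.threshold
  split_ifs <;> linarith
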